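/- Let $G=(V,E)$ be a finite simple connected undirected graph and let $w\colon E\to\mathbb{R}$ be a weight function with $w(e)>0$ for every $e\in E$. Denote by $S(G)$ the set of spanning trees of $G$ and put $$P_{G,w}=\sum_{T\in S(G)}\ \prod_{e\in T}w(e)\prod_{v\in V}x_v^{\deg_T(v)-1},\qquad P_G=\sum_{T\in S(G)}\ \prod_{v\in V}x_v^{\deg_T(v)-1}$$ (if $|V|=1$, both polynomials are taken to be $1$). A polynomial with real coefficients is called real stable if it does not vanish whenever all of its variables take values in the open upper half-plane $\{z\in\mathbb{C}:\operatorname{Im} z>0\}$. The graph $G$ is called stable if $P_G$ is real stable, and distance-hereditary if for every connected induced subgraph $H$ of $G$ and all vertices $u,v$ of $H$ the distance between $u$ and $v$ in $H$ equals their distance in $G$. If $P_{G,w}$ is real stable, then the unweighted graph $G$ is stable, and $G$ is distance-hereditary. -/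

import Mathlib

/-- A polynomial with real coefficients is real stable if it does not vanish when all of its
variables are in the open upper half-plane. -/
def MvPolynomial.IsRealStable {σ : Type*} (P : MvPolynomial σ ℝ) : Prop :=
  ∀ z : σ → ℂ, (∀ i, 0 < (z i).im) → MvPolynomial.aeval z P ≠ 0

namespace SimpleGraph

open Classical in
/-- The finite set `S(G)` of all spanning trees of `G`: the trees on the whole vertex set of `G`
all of whose edges are edges of `G`. -/
noncomputable def spanningTrees {V : Type*} [Fintype V] (G : SimpleGraph V) :
    Finset (SimpleGraph V) :=
  {T : SimpleGraph V | T ≤ G ∧ T.IsTree}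

open Classical in
/-- The vertex spanning polynomial `P_G = ∑_T ∏_v x_v ^ (deg_T v - 1)`. If `G` has at least two
vertices, then every degree in a spanning tree is positive, so the subtraction is not truncated;
for a graph with exactly one vertex the polynomial is `1`. -/
noncomputable def vertexSpanningPoly {V : Type*} [Fintype V] (G : SimpleGraph V) :
    MvPolynomial V ℝ :=
  ∑ T ∈ G.spanningTrees, ∏ v : V, MvPolynomial.X v ^ (T.degree v - 1)

open Classical in
/-- The weighted vertex spanning polynomial
`P_{G,w} = ∑_T (∏_{e ∈ T} w e) ∏_v x_v ^ (deg_T v - 1)`. Only the values of `w` on the edges of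
`G` matter. -/
noncomputable def weightedVertexSpanningPoly {V : Type*} [Fintype V] (G : SimpleGraph V)
    (w : Sym2 V → ℝ) : MvPolynomial V ℝ :=
  ∑ T ∈ G.spanningTrees,
    MvPolynomial.C (∏ e ∈ T.edgeFinset, w e) * ∏ v : V, MvPolynomial.X v ^ (T.degree v - 1)

/-- A graph is stable if its (unweighted) vertex spanning polynomial is real stable. -/
def IsStable {V : Type*} [Fintype V] (G : SimpleGraph V) : Prop :=
  G.vertexSpanningPoly.IsRealStable

/-- A graph is distance-hereditary if distances in every connected induced subgraph agree with
distances in the whole graph. -/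
def IsDistanceHereditary {V : Type*} (G : SimpleGraph V) : Prop :=
  ∀ s : Set V, (G.induce s).Connected → ∀ u v : s, (G.induce s).dist u v = G.dist u v

end SimpleGraph

/-! Stability for a single positive weighting already forces distance-heredity. Distance-heredity in
turn gives a way to dismantle the graph along which unweighted stability can be rebuilt.

Setting $x_v=0$ kills every spanning tree in which $v$ is not a leaf, so $P_{G,w}$ factors as
$P_{G-v,w}\cdot\sum_{u\sim v}w(vu)x_u$ (`treeSum_of_apply_eq_zero`). Combined with Hurwitz's
theorem, this makes weighted stability hereditary for connected induced subgraphs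
(`TreeStable.comap`). If distance-heredity fails, some connected induced subgraph is a fan: an
induced path on at least four vertices plus a vertex $q$ adjacent to both ends. With $a,b$ the
second and third path vertices, scaling $x_a,x_b$ by $t$ and $x_q$ by $t^2$, dividing by $t^2$ and
letting $t\to0$ with the other variables tending to $1$ leaves $\alpha x_ax_b+\beta x_q$ with
$\alpha,\beta>0$. This has zeros in the upper half-plane whatever the weights are
(`IsFan.not_treeStable`).

Conversely, a connected distance-hereditary graph with at least two vertices has a pendant vertex or
a pair of twins (`IsDistanceHereditary.exists_pendant_or_twins`). Delete a pendant vertex or one of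
two twins: the rest is connected, still weighted stable, and by induction stable with unit weights.
A pendant vertex at $u$ only contributes the factor $x_u$. For twins $v,v'$, sliding edges from one
to the other shows that $P_G$ depends on $x_v,x_{v'}$ only through their sum
(`treeSum_one_of_twins`), so one of the two variables may be set to zero and the factorization
applies again. -/

section

open Filter Topology

/-! ### Hurwitz's theorem -/

/-- Hurwitz's theorem for a one-parameter family of entire functions. -/
theorem Complex.eq_zero_of_limit_of_forall_ne_zero {F : ℝ → ℂ → ℂ}
    (hF : Continuous (Function.uncurry F)) (hd : ∀ t, Differentiable ℂ (F t)) {U : Set ℂ}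
    (hU : IsOpen U) (hne : ∀ t > 0, ∀ s ∈ U, F t s ≠ 0) {s₀ : ℂ} (hs : s₀ ∈ U)
    (h0 : F 0 s₀ = 0) : F 0 = 0 := by
  have han : AnalyticOnNhd ℂ (F 0) Set.univ := fun z _ => (hd 0).analyticAt z
  rcases (han s₀ trivial).eventually_eq_zero_or_eventually_ne_zero with h | h
  · exact han.eq_of_eventuallyEq (fun _ _ => analyticAt_const) h
  exfalso
  rw [eventually_nhdsWithin_iff] at h
  obtain ⟨r, hr, hball⟩ := Metric.nhds_basis_closedBall.eventually_iff.1
    (h.and (hU.mem_nhds hs))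
  have hcpt : IsCompact (Metric.sphere s₀ r) := isCompact_sphere _ _
  have hnon : (Metric.sphere s₀ r).Nonempty := NormedSpace.sphere_nonempty.2 hr.le
  -- On a small circle around the isolated zero, $|F_0|$ has a positive minimum $m$. For small $t>0$
  -- this gives $|F_t|>m/2$ on the circle but $|F_t(s_0)|<m/2$, against the maximum principle for
  -- $1/F_t$.
  obtain ⟨z₁, hz₁, hmin⟩ := hcpt.exists_isMinOn hnon (hd 0).continuous.norm.continuousOn
  have hm : 0 < ‖F 0 z₁‖ := by
    refine norm_pos_iff.2 ((hball (Metric.sphere_subset_closedBall hz₁)).1 ?_)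
    rintro rfl
    simp at hz₁
    exact hr.ne hz₁
  set m := ‖F 0 z₁‖
  have h1 : ∀ᶠ t in 𝓝 (0 : ℝ), ∀ s ∈ Metric.sphere s₀ r, m / 2 < ‖F t s‖ := by
    refine hcpt.eventually_forall_of_forall_eventually fun s hs' => ?_
    have hlt : m / 2 < ‖F 0 s‖ := lt_of_lt_of_le (by linarith) (hmin hs')
    exact (hF.norm.continuousAt (x := ((0 : ℝ), s))).eventually (lt_mem_nhds hlt)
  have h2 : ∀ᶠ t in 𝓝 (0 : ℝ), ‖F t s₀‖ < m / 2 := by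
    have hc : Continuous fun t => ‖F t s₀‖ :=
      (hF.comp (continuous_id.prodMk continuous_const)).norm
    refine hc.continuousAt.eventually (gt_mem_nhds ?_)
    simpa [h0] using hm
  have h3 : ∀ᶠ t in 𝓝[>] (0 : ℝ), (∀ s ∈ Metric.sphere s₀ r, m / 2 < ‖F t s‖) ∧
      ‖F t s₀‖ < m / 2 ∧ 0 < t :=
    (h1.filter_mono nhdsWithin_le_nhds).and
      ((h2.filter_mono nhdsWithin_le_nhds).and self_mem_nhdsWithin)
  obtain ⟨t, ht1, ht2, ht⟩ := h3.exists
  have hcl : closure (Metric.ball s₀ r) = Metric.closedBall s₀ r := closure_ball _ hr.ne'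
  have hdc : DiffContOnCl ℂ (fun s => (F t s)⁻¹) (Metric.ball s₀ r) := by
    refine DifferentiableOn.diffContOnCl fun s hs' => ?_
    rw [hcl] at hs'
    exact ((hd t s).inv (hne t ht s (hball hs').2)).differentiableWithinAt
  have := Complex.norm_le_of_forall_mem_frontier_norm_le Metric.isBounded_ball hdc
    (C := (m / 2)⁻¹) (fun z hz => by
      rw [frontier_ball _ hr.ne'] at hz
      rw [norm_inv]
      exact inv_anti₀ (by positivity) (ht1 z hz).le) (z := s₀)
      (subset_closure (Metric.mem_ball_self hr))
  rw [norm_inv] at this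
  have hpos : 0 < ‖F t s₀‖ := norm_pos_iff.2 (hne t ht s₀ hs)
  exact absurd ((inv_le_inv₀ hpos (by positivity)).1 this) (not_le.2 ht2)

/-! ### The polynomial as a function on complex points -/

namespace SimpleGraph

variable {V W : Type*} [Fintype V] [Fintype W]

open Classical in
/-- The value at a complex point of the weighted vertex spanning polynomial. -/
noncomputable def treeSum (G : SimpleGraph V) (w : Sym2 V → ℝ) (z : V → ℂ) : ℂ :=
  ∑ T ∈ G.spanningTrees, ((∏ e ∈ T.edgeFinset, w e : ℝ) : ℂ) * ∏ v : V, z v ^ (T.degree v - 1)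

/-- The weighted vertex spanning polynomial does not vanish on the open upper half-plane. -/
def TreeStable (G : SimpleGraph V) (w : Sym2 V → ℝ) : Prop :=
  ∀ z : V → ℂ, (∀ v, 0 < (z v).im) → G.treeSum w z ≠ 0

theorem aeval_weightedVertexSpanningPoly (G : SimpleGraph V) (w : Sym2 V → ℝ) (z : V → ℂ) :
    MvPolynomial.aeval z (G.weightedVertexSpanningPoly w) = G.treeSum w z := by
  simp [weightedVertexSpanningPoly, treeSum, map_sum, map_prod]

theorem isRealStable_weightedVertexSpanningPoly_iff (G : SimpleGraph V) (w : Sym2 V → ℝ) :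
    (G.weightedVertexSpanningPoly w).IsRealStable ↔ G.TreeStable w := by
  simp [MvPolynomial.IsRealStable, TreeStable, aeval_weightedVertexSpanningPoly]

theorem isStable_iff_treeStable_one (G : SimpleGraph V) : G.IsStable ↔ G.TreeStable 1 := by
  rw [← isRealStable_weightedVertexSpanningPoly_iff, IsStable]
  simp [weightedVertexSpanningPoly, vertexSpanningPoly]

theorem mem_spanningTrees {G T : SimpleGraph V} : T ∈ G.spanningTrees ↔ T ≤ G ∧ T.IsTree := by
  simp [spanningTrees]

open Classical in
theorem IsTree.one_le_degree [Nontrivial V] {T : SimpleGraph V} (hT : T.IsTree) (v : V) :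
    1 ≤ T.degree v :=
  hT.preconnected.degree_pos_of_nontrivial v

open Classical in
theorem prod_weight_pos {G T : SimpleGraph V} {w : Sym2 V → ℝ} (hw : ∀ e ∈ G.edgeSet, 0 < w e)
    (hT : T ≤ G) : 0 < ∏ e ∈ T.edgeFinset, w e :=
  Finset.prod_pos fun e he => hw e (edgeSet_mono hT (by simpa using he))

/-- At the all-ones point the value is a nonempty sum of positive tree weights. This is the point at
which limits are later seen not to vanish identically. -/
theorem treeSum_one_ne_zero {G : SimpleGraph V} (hG : G.Connected) {w : Sym2 V → ℝ}
    (hw : ∀ e ∈ G.edgeSet, 0 < w e) : G.treeSum w 1 ≠ 0 := by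
  classical
  obtain ⟨T, hT, hT'⟩ := hG.exists_isTree_le
  simp only [treeSum, Pi.one_apply, one_pow, Finset.prod_const_one, mul_one]
  rw [← Complex.ofReal_sum, Complex.ofReal_ne_zero]
  refine (Finset.sum_pos (fun T hT => prod_weight_pos hw (mem_spanningTrees.1 hT).1)
    ⟨T, mem_spanningTrees.2 ⟨hT, hT'⟩⟩).ne'

theorem continuous_treeSum (G : SimpleGraph V) (w : Sym2 V → ℝ) : Continuous (G.treeSum w) := by
  unfold treeSum
  fun_prop

end SimpleGraph

end

/-! ### Leaves: a vertex `v` is deleted by an embedding `f` whose range is the complement of `v` -/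

namespace SimpleGraph

variable {V W : Type*}

theorem Connected.of_retraction {G : SimpleGraph V} {H : SimpleGraph W} (hG : G.Connected)
    (r : V → W) (hr : Function.Surjective r)
    (h : ∀ x y, G.Adj x y → r x = r y ∨ H.Adj (r x) (r y)) : H.Connected := by
  have hreach : ∀ x y, G.Reachable x y → H.Reachable (r x) (r y) := by
    rintro x y ⟨p⟩
    induction p with
    | nil => rfl
    | cons hadj _ ih =>
      rcases h _ _ hadj with h | h
      · rwa [h]
      · exact h.reachable.trans ih
  have := hG.nonempty
  have : Nonempty W := this.map r
  refine ⟨fun a b => ?_⟩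
  obtain ⟨x, rfl⟩ := hr a
  obtain ⟨y, rfl⟩ := hr b
  exact hreach x y (hG.preconnected x y)

/-- The graph obtained from `T` by adding a new vertex `v` joined to `u` only. -/
def attachLeaf (f : W ↪ V) (v : V) (T : SimpleGraph W) (u : W) : SimpleGraph V :=
  T.map f ⊔ edge v (f u)

section attachLeaf

variable {f : W ↪ V} {v : V} (hf : ∀ x, x ∈ Set.range f ↔ x ≠ v) (T : SimpleGraph W) (u : W)

include hf

theorem ne_of_range (y : W) : f y ≠ v := (hf _).1 ⟨y, rfl⟩

theorem attachLeaf_adj_apply {x y : W} : (attachLeaf f v T u).Adj (f x) (f y) ↔ T.Adj x y := by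
  have h1 := ne_of_range hf x
  have h2 := ne_of_range hf y
  simp [attachLeaf, edge_adj, h1, h2]

theorem attachLeaf_adj_leaf {x : V} : (attachLeaf f v T u).Adj v x ↔ x = f u := by
  have h1 := ne_of_range hf
  have h2 : ¬ (T.map f).Adj v x := by
    rw [map_adj]
    rintro ⟨a, b, -, h, -⟩
    exact h1 a h
  have h3 := h1 u
  simp only [attachLeaf, sup_adj, h2, edge_adj, false_or]
  grind

theorem comap_attachLeaf : (attachLeaf f v T u).comap f = T := by
  ext x y
  exact attachLeaf_adj_apply hf T u

theorem edgeSet_attachLeaf :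
    (attachLeaf f v T u).edgeSet = insert s(v, f u) (f.sym2Map '' T.edgeSet) := by
  rw [attachLeaf, edgeSet_sup, edgeSet_map, edgeSet_edge_of_ne (ne_of_range hf u).symm,
    Set.union_singleton]

theorem leaf_edge_notMem (w : W) : s(v, f w) ∉ f.sym2Map '' T.edgeSet := by
  rintro ⟨e, -, he⟩
  induction e with | _ a b =>
  have h1 := ne_of_range hf a
  have h2 := ne_of_range hf b
  simp at he
  grind

theorem Connected.of_comap {G : SimpleGraph V} (hG : (G.comap f).Connected) (hu : G.Adj v (f u)) :
    G.Connected := by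
  have h : ∀ x, G.Reachable x (f u) := by
    intro x
    by_cases hx : x = v
    · subst hx
      exact hu.reachable
    · obtain ⟨y, rfl⟩ := (hf x).2 hx
      exact (hG.preconnected y u).map (⟨f, id⟩ : G.comap f →g G)
  have : Nonempty V := ⟨v⟩
  exact ⟨fun x y => (h x).trans (h y).symm⟩

theorem card_eq_of_range_eq_compl [Finite W] : Nat.card V = Nat.card W + 1 := by
  have e : Option W ≃ V := Equiv.ofBijective (fun o : Option W => o.elim v f) (by
    have h1 := ne_of_range hf
    constructor
    · rintro (_ | a) (_ | b) h
      · rfl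
      · exact absurd h.symm (h1 b)
      · exact absurd h (h1 a)
      · exact congrArg some (f.injective h)
    · intro x
      by_cases hx : x = v
      · exact ⟨none, hx.symm⟩
      · obtain ⟨y, rfl⟩ := (hf x).2 hx
        exact ⟨some y, rfl⟩)
  rw [← Nat.card_congr e, Finite.card_option]

theorem IsTree.attachLeaf [Finite W] {T : SimpleGraph W} (hT : T.IsTree) :
    (attachLeaf f v T u).IsTree := by
  have hcard := card_eq_of_range_eq_compl hf
  have hfin : Finite V := Nat.finite_of_card_ne_zero (by omega)
  rw [isTree_iff_connected_and_card] at hT ⊢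
  refine ⟨?_, ?_⟩
  · refine Connected.of_comap hf u ?_ ((attachLeaf_adj_leaf hf T u).2 rfl)
    rw [comap_attachLeaf hf]
    exact hT.1
  · rw [hcard, ← hT.2, Nat.card_coe_set_eq, edgeSet_attachLeaf hf,
      Set.ncard_insert_of_notMem (leaf_edge_notMem hf T u) (Set.toFinite _),
      Set.ncard_image_of_injective _ f.sym2Map.injective, Nat.card_coe_set_eq]

theorem eq_attachLeaf {T : SimpleGraph V} (h : ∀ x, T.Adj v x ↔ x = f u) :
    T = SimpleGraph.attachLeaf f v (T.comap f) u := by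
  ext x y
  by_cases hx : x = v
  · subst hx
    rw [h, attachLeaf_adj_leaf hf]
  by_cases hy : y = v
  · subst hy
    rw [adj_comm, h, adj_comm, attachLeaf_adj_leaf hf]
  obtain ⟨a, rfl⟩ := (hf x).2 hx
  obtain ⟨b, rfl⟩ := (hf y).2 hy
  rw [attachLeaf_adj_apply hf]
  rfl

/-- Sending `v` to `u` and fixing everything else is a retraction that maps each edge to an edge or
a point. It covers pendant vertices and twins at once. -/
theorem Connected.comap_of_dominated {G : SimpleGraph V} (hG : G.Connected)
    (h : ∀ x, G.Adj v x → x = f u ∨ G.Adj (f u) x) : (G.comap f).Connected := by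
  obtain ⟨r, hv, hr⟩ : ∃ r : V → W, r v = u ∧ ∀ y, r (f y) = y :=
    ⟨Function.extend f id fun _ => u,
      Function.extend_apply' _ _ _ (fun ⟨a, ha⟩ => ne_of_range hf a ha),
      fun y => f.injective.extend_apply _ _ y⟩
  refine hG.of_retraction r (fun y => ⟨f y, hr y⟩) fun x y hxy => ?_
  by_cases hx : x = v
  · subst hx
    obtain ⟨b, rfl⟩ := (hf y).2 hxy.ne'
    rw [hv, hr]
    exact (h _ hxy).imp (fun e => (f.injective e).symm) id
  obtain ⟨a, rfl⟩ := (hf x).2 hx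
  by_cases hy : y = v
  · subst hy
    rw [hv, hr]
    exact (h _ hxy.symm).imp (fun e => f.injective e) fun e => e.symm
  obtain ⟨b, rfl⟩ := (hf y).2 hy
  rw [hr, hr]
  exact Or.inr hxy

theorem IsTree.comap_of_leaf {T : SimpleGraph V} (hT : T.IsTree) (h : ∀ x, T.Adj v x ↔ x = f u) :
    (T.comap f).IsTree :=
  ⟨hT.connected.comap_of_dominated hf u fun x hx => Or.inl ((h x).1 hx), hT.isAcyclic.of_comap f⟩

variable [Fintype V]

open Classical in
theorem degree_attachLeaf_leaf : (attachLeaf f v T u).degree v = 1 := by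
  rw [degree_eq_one_iff_existsUnique_adj]
  exact ⟨f u, (attachLeaf_adj_leaf hf T u).2 rfl, fun y hy => (attachLeaf_adj_leaf hf T u).1 hy⟩

variable [Fintype W]

open Classical in
theorem degree_attachLeaf_apply (y : W) :
    (attachLeaf f v T u).degree (f y) = T.degree y + if y = u then 1 else 0 := by
  have h1 := ne_of_range hf
  have h2 : (attachLeaf f v T u).neighborFinset (f y) =
      (T.neighborFinset y).map f ∪ if y = u then {v} else ∅ := by
    ext x
    rw [mem_neighborFinset, Finset.mem_union, Finset.mem_map]
    by_cases hx : x = v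
    · subst hx
      rw [adj_comm, attachLeaf_adj_leaf hf]
      by_cases hy : y = u
      · simp [hy]
      · simp [hy, h1]
    · obtain ⟨a, rfl⟩ := (hf x).2 hx
      rw [attachLeaf_adj_apply hf]
      have : f a ∉ (if y = u then ({v} : Finset V) else ∅) := by
        split_ifs <;> simp [h1]
      simp [this]
  rw [← card_neighborFinset_eq_degree, h2, Finset.card_union_of_disjoint, Finset.card_map,
    card_neighborFinset_eq_degree]
  · congr 1
    split_ifs <;> simp
  · rw [Finset.disjoint_left]
    rintro x hx
    obtain ⟨a, -, rfl⟩ := Finset.mem_map.1 hx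
    split_ifs <;> simp [h1]

open Classical in
theorem prod_edgeFinset_attachLeaf {M : Type*} [CommMonoid M] (w : Sym2 V → M) :
    ∏ e ∈ (attachLeaf f v T u).edgeFinset, w e =
      w s(v, f u) * ∏ e ∈ T.edgeFinset, w (e.map f) := by
  have : (attachLeaf f v T u).edgeFinset =
      insert s(v, f u) (T.edgeFinset.map f.sym2Map) := by
    rw [← Finset.coe_inj]
    simp [edgeSet_attachLeaf hf]
  rw [this, Finset.prod_insert, Finset.prod_map]
  · rfl
  · have := leaf_edge_notMem hf T u
    rw [← Finset.mem_coe]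
    simpa using this

theorem prod_univ_eq_mul_prod {M : Type*} [CommMonoid M] (g : V → M) :
    ∏ x, g x = g v * ∏ y, g (f y) := by
  classical
  have : (Finset.univ : Finset V) = insert v (Finset.univ.map f) := by
    ext x
    have := hf x
    simp only [Set.mem_range] at this
    simp only [Finset.mem_univ, Finset.mem_insert, Finset.mem_map, true_and, this, true_iff]
    tauto
  rw [this, Finset.prod_insert, Finset.prod_map]
  simpa using fun y => ne_of_range hf y

open Classical in
/-- If the variable of a vertex `v` is zero, only the spanning trees in which `v` is a leaf
contribute. -/
theorem treeSum_of_apply_eq_zero [Nontrivial W] (G : SimpleGraph V) (w : Sym2 V → ℝ) (z : V → ℂ)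
    (hz : z v = 0) :
    G.treeSum w z = (G.comap f).treeSum (fun e => w (e.map f)) (z ∘ f) *
      ∑ u : W with G.Adj v (f u), w s(v, f u) * z (f u) := by
  have : Nontrivial V := f.injective.nontrivial
  unfold treeSum
  -- Trees with `v` of degree at least two contain a positive power of `z v = 0`. The others
  -- correspond to a spanning tree on `W` together with the neighbour to which `v` is attached.
  rw [Finset.sum_mul_sum, ← Finset.sum_product',
    ← Finset.sum_filter_of_ne (p := fun T => T.degree v = 1)]
  · symm
    refine Finset.sum_bij (fun p _ => attachLeaf f v p.1 p.2) ?_ ?_ ?_ ?_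
    · rintro ⟨T, u⟩ h
      simp only [Finset.mem_product, mem_spanningTrees, Finset.mem_filter, Finset.mem_univ,
        true_and] at h ⊢
      refine ⟨⟨?_, h.1.2.attachLeaf hf u⟩, degree_attachLeaf_leaf hf T u⟩
      refine sup_le ?_ ?_
      · exact (map_monotone f h.1.1).trans (map_comap_le f G)
      · rw [edge_le]
        intro e he
        obtain rfl := he.1
        exact h.2
    · rintro ⟨T, u⟩ h ⟨T', u'⟩ h' heq
      simp only at heq
      have h1 : T = T' := by rw [← comap_attachLeaf hf T u, heq, comap_attachLeaf hf]
      have h2 : u = u' := by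
        apply f.injective
        rw [← attachLeaf_adj_leaf hf T' u', ← heq, attachLeaf_adj_leaf hf]
      rw [h1, h2]
    · intro T hT
      simp only [Finset.mem_filter, mem_spanningTrees] at hT
      obtain ⟨⟨hTG, hT⟩, hdeg⟩ := hT
      obtain ⟨x, hx, hx'⟩ := degree_eq_one_iff_existsUnique_adj.1 hdeg
      obtain ⟨u, rfl⟩ := (hf x).2 hx.ne'
      have hadj : ∀ x, T.Adj v x ↔ x = f u := fun x => ⟨hx' x, fun h => h ▸ hx⟩
      refine ⟨(T.comap f, u), ?_, (eq_attachLeaf hf u hadj).symm⟩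
      simp only [Finset.mem_product, mem_spanningTrees, Finset.mem_filter, Finset.mem_univ,
        true_and]
      exact ⟨⟨fun a b h => hTG h, hT.comap_of_leaf hf u hadj⟩, hTG hx⟩
    · rintro ⟨T, u⟩ h
      simp only [Finset.mem_product, mem_spanningTrees] at h
      have hT := h.1.2
      rw [prod_edgeFinset_attachLeaf hf, prod_univ_eq_mul_prod hf, degree_attachLeaf_leaf hf]
      have : ∏ y, z (f y) ^ ((attachLeaf f v T u).degree (f y) - 1) =
          (∏ y, (z ∘ f) y ^ (T.degree y - 1)) * z (f u) := by
        -- Only the degree of `u` grows, by one. Degrees in `T` are positive because `W` is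
        -- nontrivial, so the truncated exponent grows by exactly one too and yields the factor `z
        -- (f u)`.
        simp_rw [degree_attachLeaf_apply hf]
        rw [← Fintype.prod_ite_eq' u (fun y => z (f y)), ← Finset.prod_mul_distrib]
        refine Finset.prod_congr rfl fun y _ => ?_
        have := hT.one_le_degree y
        split_ifs with hy
        · rw [Function.comp_apply, ← pow_succ]
          congr 1
          omega
        · simp
      simp only [this]
      push_cast
      ring
  · intro T hT h
    have := (mem_spanningTrees.1 hT).2.one_le_degree v
    by_contra hne
    refine h ?_
    rw [Finset.prod_eq_zero (Finset.mem_univ v), mul_zero]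
    rw [hz, zero_pow]
    omega

end attachLeaf

end SimpleGraph

/-! ### Weighted stability passes to connected induced subgraphs -/

namespace SimpleGraph

variable {V W : Type*}

theorem weight_comap_pos {G : SimpleGraph V} {w : Sym2 V → ℝ} (hw : ∀ e ∈ G.edgeSet, 0 < w e)
    (f : W → V) : ∀ e ∈ (G.comap f).edgeSet, 0 < w (e.map f) := by
  intro e he
  induction e with | _ a b => exact hw _ he

theorem prod_edgeFinset_map {M : Type*} [CommMonoid M] (f : W ↪ V) (T : SimpleGraph W)
    [Fintype T.edgeSet] [Fintype (T.map f).edgeSet] (w : Sym2 V → M) :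
    ∏ e ∈ (T.map f).edgeFinset, w e = ∏ e ∈ T.edgeFinset, w (e.map f) := by
  have : (T.map f).edgeFinset = T.edgeFinset.map f.sym2Map := by
    rw [← Finset.coe_inj, Finset.coe_map, coe_edgeFinset, coe_edgeFinset, edgeSet_map]
  rw [this, Finset.prod_map]
  rfl

variable [Fintype V] [Fintype W]

theorem treeSum_comap_of_bijective (G : SimpleGraph V) (w : Sym2 V → ℝ) (f : W ↪ V)
    (hf : Function.Bijective f) (z : V → ℂ) :
    (G.comap f).treeSum (fun d => w (d.map f)) (z ∘ f) = G.treeSum w z := by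
  classical
  unfold treeSum
  have hiso : ∀ T : SimpleGraph V, Nonempty (T.comap f ≃g T) := fun T =>
    ⟨Iso.comap (Equiv.ofBijective f hf) T⟩
  refine Finset.sum_bij' (fun T _ => T.map f) (fun T _ => T.comap f) ?_ ?_ ?_ ?_ ?_
  · intro T hT
    rw [mem_spanningTrees] at hT ⊢
    refine ⟨(map_monotone f hT.1).trans (map_comap_le f G), ?_⟩
    obtain ⟨e⟩ := hiso (T.map f)
    rw [← e.isTree_iff, comap_map_eq]
    exact hT.2
  · intro T hT
    rw [mem_spanningTrees] at hT ⊢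
    obtain ⟨e⟩ := hiso T
    exact ⟨fun a b h => hT.1 h, e.isTree_iff.2 hT.2⟩
  · intro T _
    exact comap_map_eq f T
  · intro T _
    ext x y
    obtain ⟨a, rfl⟩ := hf.2 x
    obtain ⟨b, rfl⟩ := hf.2 y
    rw [map_adj_apply, comap_adj]
  · intro T _
    congr 1
    · refine congrArg _ (Eq.symm ?_)
      convert prod_edgeFinset_map f T w
    · refine Fintype.prod_bijective f hf _ _ fun x => ?_
      have : (T.map f).degree (f x) = T.degree x := by
        rw [← card_neighborSet_eq_degree, ← card_neighborSet_eq_degree,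
          ← Nat.card_eq_fintype_card, ← Nat.card_eq_fintype_card, neighborSet_map]
        exact Nat.card_image_of_injective f.injective _
      rw [Function.comp_apply, ← this]
      congr!

/-- All exponents are zero on at most two vertices, so the polynomial is a nonzero constant. -/
theorem treeStable_of_card_le_two {G : SimpleGraph V} (hG : G.Connected) {w : Sym2 V → ℝ}
    (hw : ∀ e ∈ G.edgeSet, 0 < w e) (hV : Fintype.card V ≤ 2) : G.TreeStable w := by
  classical
  intro z _
  have : G.treeSum w z = G.treeSum w 1 := by
    refine Finset.sum_congr rfl fun T _ => ?_
    congr 1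
    refine Finset.prod_congr rfl fun v _ => ?_
    have := T.degree_lt_card_verts v
    rw [show T.degree v - 1 = 0 by omega]
    simp
  rw [this]
  exact treeSum_one_ne_zero hG hw

/-- Weighted stability is inherited when a vertex whose removal keeps the graph connected is
removed. -/
theorem TreeStable.comap_of_range_eq_compl {f : W ↪ V} {v : V}
    (hf : ∀ x, x ∈ Set.range f ↔ x ≠ v) {G : SimpleGraph V} (hG : G.Connected)
    {w : Sym2 V → ℝ} (hw : ∀ e ∈ G.edgeSet, 0 < w e) (hH : (G.comap f).Connected)
    (h : G.TreeStable w) : (G.comap f).TreeStable (fun e => w (e.map f)) := by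
  classical
  rcases subsingleton_or_nontrivial W with hW | hW
  · exact treeStable_of_card_le_two hH (weight_comap_pos hw f)
      ((Fintype.card_le_one_iff_subsingleton.2 hW).trans one_le_two)
  have : Nontrivial V := f.injective.nontrivial
  intro z hz h0
  -- The variable of `v` is `t * I`, which tends to zero, while the others run along the complex
  -- line from `z` at `s = 0` to the all-ones point at `s = 1`. A zero at `z` would make the limit
  -- vanish on the whole line, which fails at `s = 1`; that point need not lie in the region `U`.
  let Z : ℝ → ℂ → V → ℂ := fun t s x =>
    if x = v then t * Complex.I else (1 - s) * Function.extend f z 0 x + s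
  have hZv : ∀ t s, Z t s v = t * Complex.I := fun t s => if_pos rfl
  have hZf : ∀ t s y, Z t s (f y) = (1 - s) * z y + s := fun t s y => by
    simp only [Z]
    rw [if_neg (ne_of_range hf y), f.injective.extend_apply]
  have key := Complex.eq_zero_of_limit_of_forall_ne_zero (F := fun t s => G.treeSum w (Z t s))
    (U := ⋂ y, {s : ℂ | 0 < ((1 - s) * z y + s).im}) (s₀ := 0) ?_ ?_ ?_ ?_ ?_ ?_
  · have h1 := congrFun key 1
    simp only [Pi.zero_apply] at h1
    rw [treeSum_of_apply_eq_zero hf G w _ (by simp [hZv])] at h1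
    have h2 : Z 0 1 ∘ f = 1 := by
      ext y
      simp [hZf]
    rw [h2, mul_eq_zero] at h1
    rcases h1 with h1 | h1
    · exact treeSum_one_ne_zero hH (weight_comap_pos hw f) h1
    · have h3 : ∀ u, Z 0 1 (f u) = 1 := fun u => by simp [hZf]
      simp only [h3, mul_one] at h1
      rw [← Complex.ofReal_sum, Complex.ofReal_eq_zero] at h1
      refine (Finset.sum_pos (fun u hu => hw _ ?_) ?_).ne' h1
      · simpa using hu
      · obtain ⟨x, hx⟩ : ∃ x, G.Adj v x := by
          have := hG.preconnected.degree_pos_of_nontrivial v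
          rwa [degree_pos_iff_exists_adj] at this
        obtain ⟨u, rfl⟩ := (hf x).2 hx.ne'
        exact ⟨u, by simpa using hx⟩
  · refine (continuous_treeSum G w).comp (continuous_pi fun x => ?_)
    by_cases hx : x = v
    · simp only [Z, hx, if_true]
      fun_prop
    · simp only [Z, hx, if_false]
      fun_prop
  · intro t
    unfold treeSum
    have : ∀ x, Differentiable ℂ fun s => Z t s x := by
      intro x
      by_cases hx : x = v
      · simp only [Z, hx, if_true]
        fun_prop
      · simp only [Z, hx, if_false]
        fun_prop
    fun_prop
  · exact isOpen_iInter_of_finite fun y => isOpen_lt continuous_const (by fun_prop)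
  · intro t ht s hs
    refine h _ fun x => ?_
    by_cases hx : x = v
    · subst hx
      simpa [hZv] using ht
    · obtain ⟨y, rfl⟩ := (hf x).2 hx
      rw [hZf]
      exact Set.mem_iInter.1 hs y
  · simpa using hz
  · rw [treeSum_of_apply_eq_zero hf G w _ (by simp [hZv])]
    have h2 : Z 0 0 ∘ f = z := by
      ext y
      simp [hZf]
    rw [h2, h0, zero_mul]

/-- Weighted stability is inherited by connected induced subgraphs. -/
theorem TreeStable.comap {G : SimpleGraph V} (hG : G.Connected) {w : Sym2 V → ℝ}
    (hw : ∀ e ∈ G.edgeSet, 0 < w e) (h : G.TreeStable w) {W : Type*} [Fintype W] (f : W ↪ V)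
    (hH : (G.comap f).Connected) : (G.comap f).TreeStable (fun e => w (e.map f)) := by
  induction hn : Fintype.card V - Fintype.card W generalizing W with
  | zero =>
    have hcard : Fintype.card W = Fintype.card V :=
      le_antisymm (Fintype.card_le_of_embedding f) (by omega)
    have hbij := (Fintype.bijective_iff_injective_and_card f).2 ⟨f.injective, hcard⟩
    intro z hz h0
    let e : W ≃ V := Equiv.ofBijective f hbij
    have hez : (z ∘ e.symm) ∘ f = z := funext fun a => congrArg z (e.symm_apply_apply a)
    refine h (z ∘ e.symm) (fun v => hz _) ?_
    rw [← treeSum_comap_of_bijective G w f hbij, hez]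
    exact h0
  | succ n ih =>
    -- By connectedness some vertex `x` outside the range has a neighbour inside. Adding `x` keeps
    -- the subgraph connected, so induction on the number of missing vertices applies, and then `x`
    -- is deleted.
    obtain ⟨x, hx, u, hxu⟩ : ∃ x, x ∉ Set.range f ∧ ∃ u, G.Adj x (f u) := by
      obtain ⟨a⟩ := hH.nonempty
      obtain ⟨b, hb⟩ : ∃ b, b ∉ Set.range f := by
        by_contra! hall
        have := Fintype.card_le_of_surjective f hall
        omega
      obtain ⟨p⟩ := hG.preconnected (f a) b
      obtain ⟨d, -, hd1, hd2⟩ := p.exists_boundary_dart (Set.range f) ⟨a, rfl⟩ hb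
      obtain ⟨u, hu⟩ := hd1
      exact ⟨d.snd, hd2, u, hu ▸ d.adj.symm⟩
    let g : Option W ↪ V := f.optionElim x hx
    have hrange : ∀ o : Option W, o ∈ Set.range (Function.Embedding.some : W ↪ Option W) ↔
        o ≠ none := by
      rintro (_ | a) <;> simp
    have hg : (G.comap g).Connected := by
      refine Connected.of_comap hrange u ?_ hxu
      exact hH
    have hs := ih g hg (by rw [Fintype.card_option]; omega)
    have := TreeStable.comap_of_range_eq_compl hrange hg (weight_comap_pos hw g) hH hs
    simp only [Sym2.map_map] at this
    exact this

end SimpleGraph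

/-! ### Fans with a long path are not stable for any weights -/

namespace SimpleGraph

variable {V : Type*}

/-- `G` is an induced path `p 0, …, p k` together with a vertex `q` adjacent to both ends of
the path, and possibly to further vertices of the path. -/
structure IsFan (G : SimpleGraph V) (p : ℕ → V) (q : V) (k : ℕ) : Prop where
  cover : ∀ x, x = q ∨ ∃ i ≤ k, x = p i
  adj_iff : ∀ i ≤ k, ∀ j ≤ k, G.Adj (p i) (p j) ↔ i + 1 = j ∨ j + 1 = i
  inj : ∀ i ≤ k, ∀ j ≤ k, p i = p j → i = j
  ne : ∀ i ≤ k, p i ≠ q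
  adj_first : G.Adj q (p 0)
  adj_last : G.Adj q (p k)

namespace IsFan

variable {G : SimpleGraph V} {p : ℕ → V} {q : V} {k : ℕ} (h : G.IsFan p q k)

include h

/-- A leaf `q` cannot join two parts of the path. The cut `S` consists of `p 0, …, p i`, together
with `q` if its only neighbour lies there; the only edge of `T` that can leave `S` is the path edge
from `p i` to `p (i + 1)`. -/
theorem adj_of_leaf {T : SimpleGraph V} (hTG : T ≤ G) (hT : T.Connected) {r : V}
    (hr : ∀ x, T.Adj q x ↔ x = r) {i : ℕ} (hi : i < k) : T.Adj (p i) (p (i + 1)) := by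
  by_contra hnot
  obtain ⟨m, hm, rfl⟩ : ∃ m ≤ k, r = p m :=
    (h.cover r).resolve_left fun e => ((hr r).2 rfl).ne e.symm
  obtain ⟨w⟩ := hT.preconnected (p i) (p (i + 1))
  let S : Set V := {x | (∃ j ≤ i, x = p j) ∨ (x = q ∧ m ≤ i)}
  have h1 : p i ∈ S := Or.inl ⟨i, le_rfl, rfl⟩
  have h2 : p (i + 1) ∉ S := by
    rintro (⟨j, hj, e⟩ | ⟨e, -⟩)
    · have := h.inj _ (by omega) _ (by omega) e
      omega
    · exact h.ne _ (by omega) e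
  obtain ⟨d, -, hd1, hd2⟩ := w.exists_boundary_dart S h1 h2
  have had := d.adj
  rcases hd1 with ⟨j, hj, e⟩ | ⟨e, hmi⟩
  · rw [e] at had
    rcases h.cover d.snd with e' | ⟨j', hj', e'⟩
    · rw [e'] at had
      refine hd2 (Or.inr ⟨e', ?_⟩)
      have := h.inj _ (by omega) _ hm ((hr _).1 had.symm)
      omega
    · rw [e'] at had
      have h3 := (h.adj_iff j (by omega) j' hj').1 (hTG had)
      have h4 : ¬ j' ≤ i := fun hle => hd2 (Or.inl ⟨j', hle, e'⟩)
      have h5 : j = i := by omega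
      have h6 : j' = i + 1 := by omega
      rw [h5, h6] at had
      exact hnot had
  · rw [e] at had
    exact hd2 (Or.inl ⟨m, hmi, (hr _).1 had⟩)

theorem nontrivial : Nontrivial V := ⟨q, p 0, (h.ne 0 (Nat.zero_le k)).symm⟩

variable [Fintype V]

open Classical in
theorem two_le_degree_of_leaf {T : SimpleGraph V} (hTG : T ≤ G) (hT : T.Connected)
    (hq : T.degree q = 1) {i : ℕ} (hi0 : 0 < i) (hi : i < k) : 2 ≤ T.degree (p i) := by
  obtain ⟨r, hr, hr'⟩ := degree_eq_one_iff_existsUnique_adj.1 hq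
  have hr : ∀ x, T.Adj q x ↔ x = r := fun x => ⟨hr' x, fun e => e ▸ hr⟩
  have h1 := h.adj_of_leaf hTG hT hr hi
  have h2 := h.adj_of_leaf hTG hT hr (i := i - 1) (by omega)
  rw [Nat.sub_add_cancel hi0] at h2
  rw [← card_neighborFinset_eq_degree, ← Finset.card_pair (a := p (i - 1)) (b := p (i + 1))]
  · refine Finset.card_le_card fun x hx => ?_
    rcases Finset.mem_insert.1 hx with rfl | hx
    · simpa using h2.symm
    · rw [Finset.mem_singleton.1 hx]
      simpa using h1
  · intro e
    have := h.inj _ (by omega) _ (by omega) e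
    omega

open Classical in
/-- There is a spanning tree in which `q` is a leaf and `p 1`, `p 2` have degree two. -/
theorem exists_tree_leaf (hk : 3 ≤ k) : ∃ T ∈ G.spanningTrees, T.degree q = 1 ∧
    T.degree (p 1) = 2 ∧ T.degree (p 2) = 2 := by
  have := h.nontrivial
  -- Keep the whole path and, at `q`, only the edge to `p 0`.
  let H : SimpleGraph V :=
    { Adj := fun x y => G.Adj x y ∧ (x = q → y = p 0) ∧ (y = q → x = p 0)
      symm := ⟨fun x y hxy => ⟨hxy.1.symm, hxy.2.2, hxy.2.1⟩⟩
      loopless := ⟨fun x hx => hx.1.ne rfl⟩ }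
  have hHG : H ≤ G := fun x y hxy => hxy.1
  have hpath : ∀ i < k, H.Adj (p i) (p (i + 1)) := fun i hi =>
    ⟨(h.adj_iff i (by omega) _ (by omega)).2 (Or.inl rfl), fun e => (h.ne _ (by omega) e).elim,
      fun e => (h.ne _ (by omega) e).elim⟩
  have hreach : ∀ i ≤ k, H.Reachable (p i) (p 0) := by
    intro i
    induction i with
    | zero => intro _; rfl
    | succ i ih => intro hi; exact (hpath i hi).symm.reachable.trans (ih (by omega))
  have hreach' : ∀ x, H.Reachable x (p 0) := by
    intro x
    rcases h.cover x with rfl | ⟨i, hi, rfl⟩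
    · exact Adj.reachable ⟨h.adj_first, fun _ => rfl, fun e => (h.ne 0 (by omega) e).elim⟩
    · exact hreach i hi
  have hH : H.Connected :=
    { preconnected := fun x y => (hreach' x).trans (hreach' y).symm
      nonempty := ⟨q⟩ }
  obtain ⟨T, hTH, hT⟩ := hH.exists_isTree_le
  have hTG := hTH.trans hHG
  have hq : T.degree q = 1 := by
    refine le_antisymm ?_ (hT.one_le_degree q)
    rw [← card_neighborFinset_eq_degree, ← Finset.card_singleton (p 0)]
    refine Finset.card_le_card fun x hx => ?_
    rw [Finset.mem_singleton]
    exact (hTH (by simpa using hx : T.Adj q x)).2.1 rfl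
  have hle : ∀ i, 0 < i → i < k → T.degree (p i) = 2 := by
    intro i hi0 hi
    refine le_antisymm ?_ (h.two_le_degree_of_leaf hTG hT.connected hq hi0 hi)
    rw [← card_neighborFinset_eq_degree]
    refine (Finset.card_le_card (t := {p (i - 1), p (i + 1)}) fun x hx => ?_).trans
      Finset.card_le_two
    have hx := hTH (by simpa using hx : T.Adj (p i) x)
    rcases h.cover x with rfl | ⟨j, hj, rfl⟩
    · have := h.inj _ (by omega) _ (by omega) (hx.2.2 rfl)
      omega
    · rcases (h.adj_iff i (by omega) j hj).1 hx.1 with rfl | rfl <;> simp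
  exact ⟨T, mem_spanningTrees.2 ⟨hTG, hT⟩, hq, hle 1 (by omega) (by omega),
    hle 2 (by omega) (by omega)⟩

open Classical in
/-- There is a spanning tree in which `q` has degree two and `p 1`, `p 2` are leaves. -/
theorem exists_tree_two_leaves (hk : 3 ≤ k) : ∃ T ∈ G.spanningTrees, T.degree q = 2 ∧
    T.degree (p 1) = 1 ∧ T.degree (p 2) = 1 := by
  have := h.nontrivial
  -- Keep at `q` only the edges to the two ends and remove the path edge between `p 1` and `p 2`: a
  -- cycle with one edge cut out.
  let H : SimpleGraph V :=
    { Adj := fun x y => G.Adj x y ∧ (x = q → y = p 0 ∨ y = p k) ∧ (y = q → x = p 0 ∨ x = p k) ∧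
        ¬ (x = p 1 ∧ y = p 2) ∧ ¬ (y = p 1 ∧ x = p 2)
      symm := ⟨fun x y hxy => ⟨hxy.1.symm, hxy.2.2.1, hxy.2.1, hxy.2.2.2.2, hxy.2.2.2.1⟩⟩
      loopless := ⟨fun x hx => hx.1.ne rfl⟩ }
  have hHG : H ≤ G := fun x y hxy => hxy.1
  have hpath : ∀ i < k, i ≠ 1 → H.Adj (p i) (p (i + 1)) := fun i hi hi1 =>
    ⟨(h.adj_iff i (by omega) _ (by omega)).2 (Or.inl rfl), fun e => (h.ne _ (by omega) e).elim,
      fun e => (h.ne _ (by omega) e).elim,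
      fun e => hi1 (h.inj _ (by omega) _ (by omega) e.1),
      fun e => by
        have := h.inj _ (by omega) _ (by omega) e.1
        have := h.inj _ (by omega) _ (by omega) e.2
        omega⟩
  have hq0 : H.Adj q (p 0) := ⟨h.adj_first, fun _ => Or.inl rfl,
    fun e => (h.ne 0 (by omega) e).elim, fun e => h.ne 1 (by omega) e.1.symm,
    fun e => h.ne 2 (by omega) e.2.symm⟩
  have hqk : H.Adj q (p k) := ⟨h.adj_last, fun _ => Or.inr rfl,
    fun e => (h.ne k (by omega) e).elim, fun e => h.ne 1 (by omega) e.1.symm,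
    fun e => h.ne 2 (by omega) e.2.symm⟩
  have hreach : ∀ j, j + 2 ≤ k → H.Reachable (p (k - j)) q := by
    intro j
    induction j with
    | zero => intro _; exact hqk.symm.reachable
    | succ j ih =>
      intro hj
      refine Reachable.trans (Adj.reachable ?_) (ih (by omega))
      have := hpath (k - (j + 1)) (by omega) (by omega)
      rwa [show k - (j + 1) + 1 = k - j by omega] at this
  have hreach' : ∀ x, H.Reachable x q := by
    intro x
    rcases h.cover x with rfl | ⟨i, hi, rfl⟩
    · rfl
    · rcases i with _ | _ | i
      · exact hq0.symm.reachable
      · exact (hpath 0 (by omega) (by omega)).symm.reachable.trans hq0.symm.reachable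
      · have := hreach (k - (i + 2)) (by omega)
        rwa [show k - (k - (i + 2)) = i + 1 + 1 by omega] at this
  have hH : H.Connected :=
    { preconnected := fun x y => (hreach' x).trans (hreach' y).symm
      nonempty := ⟨q⟩ }
  obtain ⟨T, hTH, hT⟩ := hH.exists_isTree_le
  have hTG := hTH.trans hHG
  have h1 : T.degree (p 1) = 1 := by
    refine le_antisymm ?_ (hT.one_le_degree _)
    rw [← card_neighborFinset_eq_degree, ← Finset.card_singleton (p 0)]
    refine Finset.card_le_card fun x hx => ?_
    rw [Finset.mem_singleton]
    have hx := hTH (by simpa using hx : T.Adj (p 1) x)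
    rcases h.cover x with rfl | ⟨j, hj, rfl⟩
    · rcases hx.2.2.1 rfl with e | e
      · exact absurd (h.inj _ (by omega) _ (by omega) e) (by omega)
      · exact absurd (h.inj _ (by omega) _ (by omega) e) (by omega)
    · rcases (h.adj_iff 1 (by omega) j hj).1 hx.1 with rfl | e
      · exact absurd ⟨rfl, rfl⟩ hx.2.2.2.1
      · rw [show j = 0 by omega]
  have h2 : T.degree (p 2) = 1 := by
    refine le_antisymm ?_ (hT.one_le_degree _)
    rw [← card_neighborFinset_eq_degree, ← Finset.card_singleton (p 3)]
    refine Finset.card_le_card fun x hx => ?_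
    rw [Finset.mem_singleton]
    have hx := hTH (by simpa using hx : T.Adj (p 2) x)
    rcases h.cover x with rfl | ⟨j, hj, rfl⟩
    · rcases hx.2.2.1 rfl with e | e
      · exact absurd (h.inj _ (by omega) _ (by omega) e) (by omega)
      · exact absurd (h.inj _ (by omega) _ (by omega) e) (by omega)
    · rcases (h.adj_iff 2 (by omega) j hj).1 hx.1 with rfl | e
      · rfl
      · obtain rfl : j = 1 := by omega
        exact absurd ⟨rfl, rfl⟩ hx.2.2.2.2
  refine ⟨T, mem_spanningTrees.2 ⟨hTG, hT⟩, le_antisymm ?_ ?_, h1, h2⟩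
  · rw [← card_neighborFinset_eq_degree]
    refine (Finset.card_le_card (t := {p 0, p k}) fun x hx => ?_).trans Finset.card_le_two
    have hx := (hTH (by simpa using hx : T.Adj q x)).2.1 rfl
    simpa using hx
  -- Were `q` a leaf, `p 1` would have degree at least two.
  · by_contra hlt
    have hq : T.degree q = 1 := le_antisymm (by omega) (hT.one_le_degree q)
    have := h.two_le_degree_of_leaf hTG hT.connected hq (i := 1) (by omega) (by omega)
    omega

end IsFan

/-- The limiting argument for three vertices `a`, `b`, `q`, whose variables are scaled by
`δ`, `δ` and `δ ^ 2`. -/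
theorem not_treeStable_of_degrees [Fintype V] {G : SimpleGraph V} {w : Sym2 V → ℝ}
    (hw : ∀ e ∈ G.edgeSet, 0 < w e) {a b q : V} (hab : a ≠ b) (haq : a ≠ q) (hbq : b ≠ q)
    (deg : SimpleGraph V → V → ℕ)
    (hdeg : ∀ T v, deg T v = (open Classical in T.degree v - 1))
    (h0 : ∀ T ∈ G.spanningTrees, deg T q = 0 → 1 ≤ deg T a ∧ 1 ≤ deg T b)
    (h1 : ∃ T ∈ G.spanningTrees, deg T q = 0 ∧ deg T a = 1 ∧ deg T b = 1)
    (h2 : ∃ T ∈ G.spanningTrees, deg T q = 1 ∧ deg T a = 0 ∧ deg T b = 0) :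
    ¬ G.TreeStable w := by
  classical
  intro hst
  let c : SimpleGraph V → ℝ := fun T => ∏ e ∈ T.edgeFinset, w e
  have hc : ∀ T ∈ G.spanningTrees, 0 < c T := fun T hT =>
    prod_weight_pos hw (mem_spanningTrees.1 hT).1
  let R : Finset V := ((Finset.univ.erase q).erase a).erase b
  have hsplit : ∀ g : V → ℂ, ∏ v, g v = g q * (g a * (g b * ∏ v ∈ R, g v)) := by
    intro g
    rw [← Finset.mul_prod_erase _ g (Finset.mem_univ q),
      ← Finset.mul_prod_erase _ g (a := a) (by simp [haq]),
      ← Finset.mul_prod_erase _ g (a := b) (by simp [hab.symm, hbq])]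
  -- Chosen so that `y` lies in the upper half-plane while `y ^ 2 = 3 - 4i` lies in the lower one.
  -- Hence the root `-(α / β) * y ^ 2` of the limit lies in the upper half-plane.
  let y : ℂ := -2 + Complex.I
  -- This is the polynomial at `Z t u` divided by `t ^ 2`. The exponent with `- 2` is not truncated:
  -- by `h0`, either `deg T q ≥ 1` or `deg T a + deg T b ≥ 2`.
  let F : ℝ → ℂ → ℂ := fun t u => ∑ T ∈ G.spanningTrees, (c T : ℂ) *
    ((t : ℂ) ^ (2 * deg T q + deg T a + deg T b - 2) * y ^ (deg T a + deg T b) * u ^ deg T q *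
      ∏ v ∈ R, (1 + t * Complex.I) ^ deg T v)
  let Z : ℝ → ℂ → V → ℂ := fun t u v =>
    if v = q then t ^ 2 * u else if v = a ∨ v = b then t * y else 1 + t * Complex.I
  have hFZ : ∀ t u, G.treeSum w (Z t u) = (t : ℂ) ^ 2 * F t u := by
    intro t u
    simp only [treeSum, F, Finset.mul_sum]
    refine Finset.sum_congr rfl fun T hT => ?_
    rw [hsplit]
    have hR : ∏ v ∈ R, Z t u v ^ (T.degree v - 1) =
        ∏ v ∈ R, (1 + t * Complex.I) ^ deg T v := by
      refine Finset.prod_congr rfl fun v hv => ?_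
      simp only [R, Finset.mem_erase] at hv
      simp [Z, hv.1, hv.2.1, hv.2.2.1, hdeg]
    rw [hR]
    have hq : Z t u q = t ^ 2 * u := by simp [Z]
    have ha : Z t u a = t * y := by simp [Z, haq]
    have hb : Z t u b = t * y := by simp [Z, hbq]
    rw [hq, ha, hb, ← hdeg, ← hdeg, ← hdeg]
    have hpow : (t : ℂ) ^ (2 * deg T q) * (t : ℂ) ^ deg T a * (t : ℂ) ^ deg T b =
        (t : ℂ) ^ 2 * (t : ℂ) ^ (2 * deg T q + deg T a + deg T b - 2) := by
      rw [← pow_add, ← pow_add, ← pow_add]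
      congr 1
      have := h0 T hT
      omega
    have hpow' := congrArg (fun X => (c T : ℂ) * X * (y ^ (deg T a) * y ^ (deg T b) *
      u ^ deg T q * ∏ v ∈ R, (1 + t * Complex.I) ^ deg T v)) hpow
    rw [mul_pow, mul_pow, mul_pow, ← pow_mul, pow_add y]
    refine Eq.trans ?_ (hpow'.trans ?_) <;> ring
  let A := G.spanningTrees.filter fun T => deg T q = 0 ∧ deg T a = 1 ∧ deg T b = 1
  let B := G.spanningTrees.filter fun T => deg T q = 1 ∧ deg T a = 0 ∧ deg T b = 0
  let α : ℝ := ∑ T ∈ A, c T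
  let β : ℝ := ∑ T ∈ B, c T
  have hα : 0 < α := by
    obtain ⟨T, hT, h⟩ := h1
    exact Finset.sum_pos (fun T hT => hc T (Finset.mem_filter.1 hT).1)
      ⟨T, Finset.mem_filter.2 ⟨hT, h⟩⟩
  have hβ : 0 < β := by
    obtain ⟨T, hT, h⟩ := h2
    exact Finset.sum_pos (fun T hT => hc T (Finset.mem_filter.1 hT).1)
      ⟨T, Finset.mem_filter.2 ⟨hT, h⟩⟩
  -- At `t = 0` only trees with exponent zero of `t` survive, which by `h0` have `(deg q, deg a, deg
  -- b)` equal to `(0, 1, 1)` or `(1, 0, 0)`.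
  have hF0 : ∀ u, F 0 u = α * y ^ 2 + β * u := by
    intro u
    simp only [F, α, β, A, B, Complex.ofReal_sum, Finset.sum_filter, Finset.sum_mul,
      ← Finset.sum_add_distrib]
    refine Finset.sum_congr rfl fun T hT => ?_
    simp only [Complex.ofReal_zero, zero_mul, add_zero, one_pow, Finset.prod_const_one, mul_one]
    have := h0 T hT
    by_cases hA : deg T q = 0 ∧ deg T a = 1 ∧ deg T b = 1
    · simp [hA.1, hA.2.1, hA.2.2]
    by_cases hB : deg T q = 1 ∧ deg T a = 0 ∧ deg T b = 0
    · simp [hB.1, hB.2.1, hB.2.2]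
    rw [zero_pow (by omega), if_neg hA, if_neg hB]
    simp
  have key := Complex.eq_zero_of_limit_of_forall_ne_zero (F := F) (U := {u : ℂ | 0 < u.im})
    (s₀ := -(α / β : ℝ) * y ^ 2) ?_ ?_ ?_ ?_ ?_ ?_
  · have := congrFun key 0
    rw [hF0, Pi.zero_apply, mul_zero, add_zero, mul_eq_zero] at this
    rcases this with h | h
    · exact hα.ne' (by exact_mod_cast h)
    · have h := congrArg Complex.im (pow_eq_zero_iff two_ne_zero |>.1 h)
      simp [y] at h
  · simp only [F, Function.uncurry_def]
    fun_prop
  · intro t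
    simp only [F]
    fun_prop
  · exact isOpen_lt continuous_const Complex.continuous_im
  · intro t ht u hu h
    refine hst (Z t u) (fun v => ?_) (by rw [hFZ, h, mul_zero])
    simp only [Z]
    split_ifs
    · have : ((t : ℂ) ^ 2 * u).im = t ^ 2 * u.im := by
        rw [← Complex.ofReal_pow, Complex.im_ofReal_mul]
      rw [this]
      exact mul_pos (pow_pos ht 2) hu
    · simpa [y] using ht
    · simpa using ht
  · have : y ^ 2 = ((3 : ℝ) : ℂ) + ((-4 : ℝ) : ℂ) * Complex.I := by
      simp only [y]
      push_cast
      linear_combination Complex.I_sq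
    have hpos : 0 < α / β := div_pos hα hβ
    rw [Set.mem_ofPred_eq, this, ← Complex.ofReal_neg, Complex.im_ofReal_mul]
    simp
    linarith
  · rw [hF0]
    push_cast
    have : (β : ℂ) ≠ 0 := by exact_mod_cast hβ.ne'
    field_simp
    ring

/-- For `k ≥ 3` the vertices `p 1` and `p 2` are interior to the path, so both have degree at least
two in any spanning tree where `q` is a leaf. This is what the scaling argument needs. -/
theorem IsFan.not_treeStable [Fintype V] {G : SimpleGraph V} {p : ℕ → V} {q : V} {k : ℕ}
    (h : G.IsFan p q k) (hk : 3 ≤ k) {w : Sym2 V → ℝ} (hw : ∀ e ∈ G.edgeSet, 0 < w e) :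
    ¬ G.TreeStable w := by
  classical
  have := h.nontrivial
  refine not_treeStable_of_degrees hw (a := p 1) (b := p 2) (q := q) ?_ (h.ne 1 (by omega))
    (h.ne 2 (by omega)) (fun T v => T.degree v - 1) (fun T v => by congr!) ?_ ?_ ?_
  · intro e
    exact absurd (h.inj _ (by omega) _ (by omega) e) (by omega)
  · intro T hT hq
    rw [mem_spanningTrees] at hT
    have hq' := hT.2.one_le_degree q
    have h1 := h.two_le_degree_of_leaf hT.1 hT.2.connected (by omega) (i := 1) (by omega)
      (by omega)
    have h2 := h.two_le_degree_of_leaf hT.1 hT.2.connected (by omega) (i := 2) (by omega)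
      (by omega)
    omega
  · obtain ⟨T, hT, h1, h2, h3⟩ := h.exists_tree_leaf hk
    exact ⟨T, hT, by omega, by omega, by omega⟩
  · obtain ⟨T, hT, h1, h2, h3⟩ := h.exists_tree_two_leaves hk
    exact ⟨T, hT, by omega, by omega, by omega⟩

end SimpleGraph

/-! ### Weighted stability implies distance-heredity -/

namespace SimpleGraph

variable {V : Type*}

theorem IsFan.connected {G : SimpleGraph V} {p : ℕ → V} {q : V} {k : ℕ} (h : G.IsFan p q k) :
    G.Connected := by
  have hreach : ∀ i ≤ k, G.Reachable (p i) q := by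
    intro i
    induction i with
    | zero => intro _; exact h.adj_first.symm.reachable
    | succ i ih =>
      intro hi
      have hadj := (h.adj_iff i (by omega) (i + 1) hi).2 (Or.inl rfl)
      exact hadj.symm.reachable.trans (ih (by omega))
  have hreach' : ∀ x, G.Reachable x q := by
    intro x
    rcases h.cover x with rfl | ⟨i, hi, rfl⟩
    · rfl
    · exact hreach i hi
  exact { preconnected := fun x y => (hreach' x).trans (hreach' y).symm, nonempty := ⟨q⟩ }

theorem Connected.dist_getVert {G : SimpleGraph V} (hG : G.Connected) {a b : V} (p : G.Walk a b)
    (hp : p.length = G.dist a b) {i : ℕ} (hi : i ≤ p.length) : G.dist a (p.getVert i) = i := by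
  have h1 := dist_le (p.take i)
  have h2 := dist_le (p.drop i)
  have h3 := hG.dist_triangle (u := a) (v := p.getVert i) (w := b)
  rw [Walk.take_length] at h1
  rw [Walk.drop_length] at h2
  omega

/-- In a weighted stable graph, a new vertex never creates a shortcut in a connected induced
subgraph. -/
theorem TreeStable.dist_le_two [Fintype V] {G : SimpleGraph V} (hG : G.Connected)
    {w : Sym2 V → ℝ} (hw : ∀ e ∈ G.edgeSet, 0 < w e) (h : G.TreeStable w) {s : Set V}
    (hs : (G.induce s).Connected) {q : V} (hq : q ∉ s) {a b : s} (ha : G.Adj q a)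
    (hb : G.Adj q b) : (G.induce s).dist a b ≤ 2 := by
  classical
  by_contra! hlt
  -- A geodesic of `G.induce s` is an induced path; here it has length at least three, and with `q`
  -- it spans a fan.
  obtain ⟨W, hW⟩ := hs.exists_walk_length_eq_dist a b
  set k := W.length with hk
  have hd : ∀ i ≤ k, (G.induce s).dist a (W.getVert i) = i := fun i hi => hs.dist_getVert W hW hi
  let S : Set V := {x | x = q ∨ ∃ i ≤ k, x = W.getVert i}
  let Q : S := ⟨q, Or.inl rfl⟩
  -- The minimum only makes `P` total; indices beyond `k` are never used.
  let P : ℕ → S := fun i => ⟨W.getVert (min i k), Or.inr ⟨_, min_le_right _ _, rfl⟩⟩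
  have hP : ∀ i ≤ k, (P i : V) = W.getVert i := fun i hi => by simp [P, min_eq_left hi]
  have hinj : ∀ i ≤ k, ∀ j ≤ k, (W.getVert i : V) = W.getVert j → i = j := by
    intro i hi j hj e
    rw [← hd i hi, ← hd j hj, Subtype.ext e]
  have hfan : (G.comap (Function.Embedding.subtype (· ∈ S))).IsFan P Q k := by
    refine ⟨?_, ?_, ?_, ?_, ?_, ?_⟩
    · rintro ⟨x, rfl | ⟨i, hi, rfl⟩⟩
      · exact Or.inl rfl
      · exact Or.inr ⟨i, hi, Subtype.ext (hP i hi).symm⟩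
    · intro i hi j hj
      change G.Adj (P i) (P j) ↔ _
      rw [hP i hi, hP j hj]
      constructor
      · intro hadj
        have h1 : (G.induce s).Adj (W.getVert i) (W.getVert j) := hadj
        have h2 := hs.dist_triangle (u := a) (v := W.getVert i) (w := W.getVert j)
        have h3 := hs.dist_triangle (u := a) (v := W.getVert j) (w := W.getVert i)
        rw [dist_eq_one_iff_adj.2 h1, hd i hi, hd j hj] at h2
        rw [dist_eq_one_iff_adj.2 h1.symm, hd i hi, hd j hj] at h3
        have h4 : i ≠ j := by
          rintro rfl
          exact hadj.ne rfl
        omega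
      · rintro (rfl | rfl)
        · exact W.adj_getVert_succ (by omega)
        · exact (W.adj_getVert_succ (by omega)).symm
    · intro i hi j hj e
      exact hinj i hi j hj (by rw [← hP i hi, ← hP j hj, e])
    · intro i hi e
      have : (W.getVert i : V) = q := (hP i hi).symm.trans (congrArg Subtype.val e)
      exact hq (this ▸ (W.getVert i).2)
    · change G.Adj q (P 0)
      rw [hP 0 (by omega), Walk.getVert_zero]
      exact ha
    · change G.Adj q (P k)
      rw [hP k le_rfl, hk, Walk.getVert_length]
      exact hb
  exact hfan.not_treeStable (by omega) (weight_comap_pos hw _)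
    (h.comap hG hw (Function.Embedding.subtype (· ∈ S)) hfan.connected)

theorem Connected.induce_insert {G : SimpleGraph V} {s : Set V} (hs : (G.induce s).Connected)
    {q u : V} (hu : u ∈ s) (hqu : G.Adj q u) : (G.induce (insert q s)).Connected := by
  let ι : G.induce s →g G.induce (insert q s) :=
    ⟨fun x => ⟨x, Set.mem_insert_of_mem q x.2⟩, id⟩
  let u' : (insert q s : Set V) := ⟨u, Set.mem_insert_of_mem q hu⟩
  have h : ∀ x, (G.induce (insert q s)).Reachable x u' := by
    rintro ⟨x, rfl | hx⟩
    · exact Adj.reachable (v := u') hqu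
    · exact (hs.preconnected ⟨x, hx⟩ ⟨u, hu⟩).map ι
  exact { preconnected := fun x y => (h x).trans (h y).symm, nonempty := ⟨u'⟩ }

/-- If no new vertex ever creates a shortcut in a connected induced subgraph, then the graph is
distance-hereditary. -/
theorem isDistanceHereditary_of_dist_le_two [Finite V] {G : SimpleGraph V} (hG : G.Connected)
    (h : ∀ s : Set V, (G.induce s).Connected → ∀ q ∉ s, ∀ a b : s, G.Adj q a → G.Adj q b →
      (G.induce s).dist a b ≤ 2) : G.IsDistanceHereditary := by
  -- Induction on the number of vertices outside `s`, adding one neighbour `q` of `s` at a time.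
  have main : ∀ (n : ℕ) (s : Set V), sᶜ.ncard = n → (G.induce s).Connected →
      ∀ u v : s, (G.induce s).dist u v ≤ G.dist u v := by
    intro n
    induction n with
    | zero =>
      intro s hn hs u v
      rw [Set.ncard_eq_zero (Set.toFinite _), Set.compl_empty_iff] at hn
      obtain ⟨p, hp⟩ := hG.exists_walk_length_eq_dist u v
      let ι : G →g G.induce s := ⟨fun x => ⟨x, hn ▸ trivial⟩, id⟩
      rw [← hp, ← Walk.length_map ι p]
      exact dist_le (p.map ι)
    | succ n ih =>
      intro s hn hs u v
      obtain ⟨x, hx⟩ := hs.nonempty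
      obtain ⟨y, hy⟩ : sᶜ.Nonempty := Set.nonempty_of_ncard_ne_zero (by omega)
      obtain ⟨p⟩ := hG.preconnected x y
      obtain ⟨d, -, hd1, hd2⟩ := p.exists_boundary_dart s hx hy
      set q := d.snd
      have hs' : (G.induce (insert q s)).Connected := hs.induce_insert hd1 d.adj.symm
      have hcard : (insert q s)ᶜ.ncard = n := by
        have : (insert q s)ᶜ = sᶜ \ {q} := by
          ext z
          simp only [Set.mem_compl_iff, Set.mem_insert_iff, Set.mem_sdiff, Set.mem_singleton_iff]
          tauto
        rw [this, Set.ncard_sdiff_singleton_of_mem hd2, hn]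
        rfl
      -- A walk through `q` enters from a vertex of `s` and leaves to one, and these two are at
      -- distance at most two inside `s`. Every detour through `q` can thus be replaced at no cost.
      have hle : ∀ (m : ℕ) (u v : s) (u' v' : (insert q s : Set V)), (u' : V) = u → (v' : V) = v →
          ∀ W : (G.induce (insert q s)).Walk u' v', W.length = m → (G.induce s).dist u v ≤ m := by
        intro m
        induction m using Nat.strong_induction_on with
        | _ m ihm =>
          intro u v u' v' hu hv W hW
          cases W with
          | nil => simp [Subtype.ext (hu.symm.trans hv)]
          | @cons _ b _ hadj W =>
            rw [Walk.length_cons] at hW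
            have hadj : G.Adj u' b := hadj
            rw [hu] at hadj
            rcases b.2 with hb | hb
            · rw [hb] at hadj
              cases W with
              | nil => exact absurd (by rw [← hb, hv]; exact v.2) hd2
              | @cons _ c _ hadj' W =>
                rw [Walk.length_cons] at hW
                have hadj' : G.Adj b c := hadj'
                rw [hb] at hadj'
                rcases c.2 with hc | hc
                · exact absurd hc.symm hadj'.ne
                · have h1 := h s hs q hd2 u ⟨c, hc⟩ hadj.symm hadj'
                  have h2 := ihm W.length (by omega) ⟨c, hc⟩ v c v' rfl hv W rfl
                  have h3 := hs.dist_triangle (u := u) (v := ⟨c, hc⟩) (w := v)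
                  omega
            · have h1 : (G.induce s).dist u ⟨b, hb⟩ = 1 := dist_eq_one_iff_adj.2 hadj
              have h2 := ihm W.length (by omega) ⟨b, hb⟩ v b v' rfl hv W rfl
              have h3 := hs.dist_triangle (u := u) (v := ⟨b, hb⟩) (w := v)
              omega
      obtain ⟨W, hW⟩ := hs'.exists_walk_length_eq_dist ⟨u, Or.inr u.2⟩ ⟨v, Or.inr v.2⟩
      exact (hle _ u v _ _ rfl rfl W rfl).trans (hW.le.trans (ih _ hcard hs' _ _))
  intro s hs u v
  refine le_antisymm (main _ s rfl hs u v) ?_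
  obtain ⟨p, hp⟩ := hs.exists_walk_length_eq_dist u v
  rw [← hp, ← Walk.length_map (Embedding.induce s).toHom p]
  exact dist_le _

theorem TreeStable.isDistanceHereditary [Fintype V] {G : SimpleGraph V} (hG : G.Connected)
    {w : Sym2 V → ℝ} (hw : ∀ e ∈ G.edgeSet, 0 < w e) (h : G.TreeStable w) :
    G.IsDistanceHereditary :=
  isDistanceHereditary_of_dist_le_two hG fun _ hs _ hq _ _ ha hb => h.dist_le_two hG hw hs hq ha hb

end SimpleGraph

/-! ### Sliding tree edges between twins -/

namespace SimpleGraph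

variable {V : Type*}

/-- The graph obtained from `T` by replacing the edge `vu` by the edge `v'u`. -/
def slide (T : SimpleGraph V) (v v' u : V) : SimpleGraph V :=
  T.deleteEdges {s(v, u)} ⊔ edge v' u

/-- `u` is a neighbour of `v` in `T` that is not on the way from `v` to `v'`. -/
def IsSlidable (T : SimpleGraph V) (v v' u : V) : Prop :=
  T.Adj v u ∧ (T.deleteEdges {s(v, u)}).Reachable v v'

namespace IsSlidable

variable {T : SimpleGraph V} {v v' u : V} (h : T.IsSlidable v v' u)

include h

/-- The edge `vu` is a bridge of the tree, and `v'` lies on the side of `v`. -/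
theorem not_reachable (hT : T.IsTree) : ¬ (T.deleteEdges {s(v, u)}).Reachable v' u := fun hr =>
  isBridge_iff.1 (isAcyclic_iff_forall_adj_isBridge.1 hT.isAcyclic h.1) (h.2.trans hr)

theorem ne (hT : T.IsTree) : v' ≠ u := by
  rintro rfl
  exact h.not_reachable hT (Reachable.refl _)

theorem not_adj (hT : T.IsTree) (hv : v ≠ v') : ¬ T.Adj v' u := by
  intro hadj
  refine h.not_reachable hT (Adj.reachable ?_)
  rw [deleteEdges_adj]
  refine ⟨hadj, ?_⟩
  have := hadj.ne
  simp only [Set.mem_singleton_iff, Sym2.eq_iff]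
  rintro (⟨e, -⟩ | ⟨e, -⟩)
  · exact hv e.symm
  · exact this e

theorem slide_adj (hT : T.IsTree) (x y : V) : (T.slide v v' u).Adj x y ↔
    (T.Adj x y ∧ ¬ (x = v ∧ y = u) ∧ ¬ (x = u ∧ y = v)) ∨ (x = v' ∧ y = u) ∨
      (x = u ∧ y = v') := by
  have h1 := h.ne hT
  simp only [slide, sup_adj, deleteEdges_adj, Set.mem_singleton_iff, Sym2.eq_iff, edge_adj]
  grind

theorem isTree_slide (hT : T.IsTree) : (T.slide v v' u).IsTree := by
  have hle : T.deleteEdges {s(v, u)} ≤ T.slide v v' u := le_sup_left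
  have hadj : (T.slide v v' u).Adj v' u := by rw [h.slide_adj hT]; tauto
  have hvu : (T.slide v v' u).Reachable v u := (h.2.mono hle).trans hadj.reachable
  refine ⟨?_, ?_⟩
  · have := hT.connected.nonempty
    refine ⟨fun x y => ?_⟩
    obtain ⟨p⟩ := hT.connected.preconnected x y
    induction p with
    | nil => rfl
    | @cons a b _ hab _ ih =>
      refine Reachable.trans ?_ ih
      by_cases he : s(a, b) = s(v, u)
      · rw [Sym2.eq_iff] at he
        rcases he with ⟨rfl, rfl⟩ | ⟨rfl, rfl⟩
        · exact hvu
        · exact hvu.symm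
      · exact (hle (by rw [deleteEdges_adj]; exact ⟨hab, he⟩)).reachable
  · exact (hT.isAcyclic.anti (deleteEdges_le _)).sup_edge_of_not_reachable (h.not_reachable hT)

theorem deleteEdges_slide (hT : T.IsTree) (hv : v ≠ v') :
    (T.slide v v' u).deleteEdges {s(v', u)} = T.deleteEdges {s(v, u)} := by
  have h1 := h.ne hT
  have h2 := h.not_adj hT hv
  have h3 := fun e => h2 (T.adj_symm e)
  ext x y
  simp only [deleteEdges_adj, h.slide_adj hT, Set.mem_singleton_iff, Sym2.eq_iff]
  grind

theorem isSlidable_slide (hT : T.IsTree) (hv : v ≠ v') :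
    (T.slide v v' u).IsSlidable v' v u := by
  refine ⟨by rw [h.slide_adj hT]; tauto, ?_⟩
  rw [h.deleteEdges_slide hT hv]
  exact h.2.symm

theorem slide_slide (hT : T.IsTree) (hv : v ≠ v') : (T.slide v v' u).slide v' v u = T := by
  rw [slide, h.deleteEdges_slide hT hv]
  ext x y
  have h1 := h.1
  have h2 := h.1.symm
  have h3 := h.1.ne
  simp only [sup_adj, deleteEdges_adj, Set.mem_singleton_iff, Sym2.eq_iff, edge_adj]
  grind

theorem slide_le {G : SimpleGraph V} (hTG : T ≤ G) (hT : T.IsTree)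
    (htw : ∀ x, x ≠ v → x ≠ v' → G.Adj v x → G.Adj v' x) : T.slide v v' u ≤ G := by
  have h1 : G.Adj v' u := htw u h.1.ne' (h.ne hT).symm (hTG h.1)
  intro x y hxy
  rw [h.slide_adj hT] at hxy
  rcases hxy with ⟨hxy, -⟩ | ⟨rfl, rfl⟩ | ⟨rfl, rfl⟩
  · exact hTG hxy
  · exact h1
  · exact h1.symm

variable [Fintype V]

open Classical in
theorem degree_slide_left (hT : T.IsTree) (hv : v ≠ v') :
    (T.slide v v' u).degree v + 1 = T.degree v := by
  have : (T.slide v v' u).neighborFinset v = (T.neighborFinset v).erase u := by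
    ext x
    have := h.1.ne
    simp only [mem_neighborFinset, h.slide_adj hT, Finset.mem_erase]
    grind
  rw [← card_neighborFinset_eq_degree, this, Finset.card_erase_add_one (by simpa using h.1),
    card_neighborFinset_eq_degree]

open Classical in
theorem degree_slide_right (hT : T.IsTree) (hv : v ≠ v') :
    (T.slide v v' u).degree v' = T.degree v' + 1 := by
  have h2 := h.not_adj hT hv
  have : (T.slide v v' u).neighborFinset v' = insert u (T.neighborFinset v') := by
    ext x
    have := h.ne hT
    simp only [mem_neighborFinset, h.slide_adj hT, Finset.mem_insert]
    grind
  rw [← card_neighborFinset_eq_degree, this, Finset.card_insert_of_notMem (by simpa using h2),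
    card_neighborFinset_eq_degree]

open Classical in
theorem degree_slide_of_ne (hT : T.IsTree) (hv : v ≠ v') {x : V} (hx : x ≠ v) (hx' : x ≠ v') :
    (T.slide v v' u).degree x = T.degree x := by
  by_cases hxu : x = u
  · subst hxu
    have h2 := fun e => h.not_adj hT hv (T.adj_symm e)
    have : (T.slide v v' x).neighborFinset x = insert v' ((T.neighborFinset x).erase v) := by
      ext y
      simp only [mem_neighborFinset, h.slide_adj hT, Finset.mem_insert, Finset.mem_erase]
      grind
    rw [← card_neighborFinset_eq_degree, this, Finset.card_insert_of_notMem (by simpa using fun _ => h2),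
      Finset.card_erase_add_one (by simpa using h.1.symm), card_neighborFinset_eq_degree]
  · have : (T.slide v v' u).neighborFinset x = T.neighborFinset x := by
      ext y
      simp only [mem_neighborFinset, h.slide_adj hT]
      grind
    rw [← card_neighborFinset_eq_degree, this, card_neighborFinset_eq_degree]

end IsSlidable

/-- The only neighbour of `v` that cannot be slid is the first vertex on the path to `v'`. So the
number of slidable neighbours is exactly the exponent `deg v - 1`. -/
theorem IsTree.exists_forall_isSlidable_iff {T : SimpleGraph V} (hT : T.IsTree) {v v' : V}
    (hv : v ≠ v') : ∃ y, T.Adj v y ∧ ∀ u, T.IsSlidable v v' u ↔ T.Adj v u ∧ u ≠ y := by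
  obtain ⟨p, hp⟩ := hT.connected.exists_isPath v v'
  cases p with
  | nil => exact absurd rfl hv
  | @cons _ y _ hvy p =>
    rw [Walk.cons_isPath_iff] at hp
    refine ⟨y, hvy, fun u => ⟨fun h => ⟨h.1, ?_⟩, fun ⟨h, hne⟩ => ⟨h, ?_⟩⟩⟩
    · rintro rfl
      refine h.not_reachable hT (Reachable.symm ⟨p.toDeleteEdges _ fun e he hmem => ?_⟩)
      rw [Set.mem_singleton_iff] at hmem
      subst hmem
      exact hp.2 (p.fst_mem_support_of_mem_edges he)
    · refine ⟨(Walk.cons hvy p).toDeleteEdges _ fun e he hmem => ?_⟩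
      rw [Set.mem_singleton_iff] at hmem
      subst hmem
      rw [Walk.edges_cons, List.mem_cons] at he
      rcases he with he | he
      · rw [Sym2.eq_iff] at he
        rcases he with ⟨-, e⟩ | ⟨e, -⟩
        · exact hne e
        · exact hvy.ne e
      · exact hp.2 (p.fst_mem_support_of_mem_edges he)

variable [Fintype V]

open Classical in
/-- Moving edges from one of two twins to the other matches the spanning trees, counted with
multiplicity. -/
theorem sum_degree_smul_eq_of_twins {M : Type*} [AddCommMonoid M] (G : SimpleGraph V) {v v' : V}
    (hv : v ≠ v') (htw : ∀ x, x ≠ v → x ≠ v' → (G.Adj v x ↔ G.Adj v' x))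
    (g g' : SimpleGraph V → M)
    (hg : ∀ T u, T.IsTree → T.IsSlidable v v' u → g T = g' (T.slide v v' u)) :
    ∑ T ∈ G.spanningTrees, (T.degree v - 1) • g T =
      ∑ T ∈ G.spanningTrees, (T.degree v' - 1) • g' T := by
  have hcount : ∀ (a b : V), a ≠ b → ∀ T : SimpleGraph V, T.IsTree →
      (Finset.univ.filter (T.IsSlidable a b)).card = T.degree a - 1 := by
    intro a b hab T hT
    obtain ⟨y, hy, hiff⟩ := hT.exists_forall_isSlidable_iff hab
    rw [← card_neighborFinset_eq_degree, ← Finset.card_erase_of_mem (a := y) (by simpa using hy)]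
    congr 1
    ext u
    simp [hiff, and_comm]
  have hsum : ∀ (a b : V), a ≠ b → ∀ k : SimpleGraph V → M,
      ∑ T ∈ G.spanningTrees, (T.degree a - 1) • k T =
        ∑ d ∈ G.spanningTrees.sigma fun T => Finset.univ.filter (T.IsSlidable a b), k d.1 := by
    intro a b hab k
    rw [Finset.sum_sigma]
    refine Finset.sum_congr rfl fun T hT => ?_
    rw [← hcount a b hab T (mem_spanningTrees.1 hT).2]
    exact (Finset.sum_const _).symm
  rw [hsum v v' hv g, hsum v' v hv.symm g']
  -- Both sides count pairs of a tree and a slidable neighbour; sliding there and back are mutually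
  -- inverse.
  refine Finset.sum_bij' (fun d _ => ⟨d.1.slide v v' d.2, d.2⟩)
    (fun d _ => ⟨d.1.slide v' v d.2, d.2⟩) ?_ ?_ ?_ ?_ ?_
  · rintro ⟨T, u⟩ hd
    simp only [Finset.mem_sigma, mem_spanningTrees, Finset.mem_filter, Finset.mem_univ,
      true_and] at hd ⊢
    exact ⟨⟨hd.2.slide_le hd.1.1 hd.1.2 fun x h1 h2 => (htw x h1 h2).1, hd.2.isTree_slide hd.1.2⟩,
      hd.2.isSlidable_slide hd.1.2 hv⟩
  · rintro ⟨T, u⟩ hd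
    simp only [Finset.mem_sigma, mem_spanningTrees, Finset.mem_filter, Finset.mem_univ,
      true_and] at hd ⊢
    exact ⟨⟨hd.2.slide_le hd.1.1 hd.1.2 fun x h1 h2 => (htw x h2 h1).2, hd.2.isTree_slide hd.1.2⟩,
      hd.2.isSlidable_slide hd.1.2 hv.symm⟩
  · rintro ⟨T, u⟩ hd
    simp only [Finset.mem_sigma, mem_spanningTrees, Finset.mem_filter, Finset.mem_univ,
      true_and] at hd ⊢
    rw [hd.2.slide_slide hd.1.2 hv]
  · rintro ⟨T, u⟩ hd
    simp only [Finset.mem_sigma, mem_spanningTrees, Finset.mem_filter, Finset.mem_univ,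
      true_and] at hd ⊢
    rw [hd.2.slide_slide hd.1.2 hv.symm]
  · rintro ⟨T, u⟩ hd
    simp only [Finset.mem_sigma, mem_spanningTrees, Finset.mem_filter, Finset.mem_univ,
      true_and] at hd ⊢
    exact hg T u hd.1.2 hd.2

open Classical in
/-- The vertex spanning polynomial depends on the variables of two twins only through their
sum. -/
theorem treeSum_one_of_twins (G : SimpleGraph V) {v v' : V}
    (hv : v ≠ v') (htw : ∀ x, x ≠ v → x ≠ v' → (G.Adj v x ↔ G.Adj v' x)) (z : V → ℂ) :
    G.treeSum 1 z =
      G.treeSum 1 (Function.update (Function.update z v (z v + z v')) v' 0) := by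
  let S : Finset V := (Finset.univ.erase v).erase v'
  let R : SimpleGraph V → ℂ := fun T => ∏ x ∈ S, z x ^ (T.degree x - 1)
  have hS : ∀ x ∈ S, x ≠ v ∧ x ≠ v' := fun x hx => by
    simp only [S, Finset.mem_erase] at hx
    exact ⟨hx.2.1, hx.1⟩
  -- Move the share `t * z v'` from the variable of `v'` to that of `v`, keeping the sum fixed. It
  -- suffices that the derivative in `t` vanishes.
  let φ : ℂ → ℂ := fun t => ∑ T ∈ G.spanningTrees,
    (z v + t * z v') ^ (T.degree v - 1) * ((1 - t) * z v') ^ (T.degree v' - 1) * R T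
  have hφ : ∀ t, G.treeSum 1 (Function.update (Function.update z v (z v + t * z v')) v'
      ((1 - t) * z v')) = φ t := by
    intro t
    refine Finset.sum_congr rfl fun T _ => ?_
    rw [← Finset.mul_prod_erase _ _ (Finset.mem_univ v),
      ← Finset.mul_prod_erase _ _ (a := v') (by simp [hv.symm])]
    have hR : ∏ x ∈ S, Function.update (Function.update z v (z v + t * z v')) v'
        ((1 - t) * z v') x ^ (T.degree x - 1) = R T :=
      Finset.prod_congr rfl fun x hx => by
        rw [Function.update_of_ne (hS x hx).2, Function.update_of_ne (hS x hx).1]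
    rw [hR, Function.update_self, Function.update_of_ne hv, Function.update_self]
    simp [mul_assoc]
  have hder : ∀ t, HasDerivAt φ (∑ T ∈ G.spanningTrees,
      ((T.degree v - 1) • (z v' * ((z v + t * z v') ^ (T.degree v - 2) *
          ((1 - t) * z v') ^ (T.degree v' - 1) * R T)) -
        (T.degree v' - 1) • (z v' * ((z v + t * z v') ^ (T.degree v - 1) *
          ((1 - t) * z v') ^ (T.degree v' - 2) * R T)))) t := by
    intro t
    refine HasDerivAt.fun_sum fun T _ => ?_
    have h1 : HasDerivAt (fun t : ℂ => z v + t * z v') (z v') t := by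
      simpa using ((hasDerivAt_id t).mul_const (z v')).const_add (z v)
    have h2 : HasDerivAt (fun t : ℂ => (1 - t) * z v') (-z v') t := by
      simpa using ((hasDerivAt_id t).const_sub 1).mul_const (z v')
    refine (((h1.fun_pow (T.degree v - 1)).mul (h2.fun_pow (T.degree v' - 1))).mul_const
      (R T)).congr_deriv ?_
    simp only [nsmul_eq_mul, Nat.sub_sub]
    ring
  have hzero : ∀ t, deriv φ t = 0 := by
    intro t
    rw [(hder t).deriv, Finset.sum_sub_distrib, sub_eq_zero]
    -- The factors `deg - 1` from differentiation are the multiplicities of the double count. A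
    -- slide lowers the degree of `v` and raises that of `v'` by one, which makes the two monomials
    -- agree.
    refine sum_degree_smul_eq_of_twins G hv htw _ _ fun T u hT h => ?_
    have h1 := h.degree_slide_left hT hv
    have h2 := h.degree_slide_right hT hv
    have h3 : R (T.slide v v' u) = R T := Finset.prod_congr rfl fun x hx => by
      rw [h.degree_slide_of_ne hT hv (hS x hx).1 (hS x hx).2]
    rw [h3, h2, ← h1]
    rfl
  have hconst := is_const_of_deriv_eq_zero (fun t => (hder t).differentiableAt) hzero 0 1
  rw [← hφ, ← hφ] at hconst
  simpa using hconst

end SimpleGraph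

/-! ### Induced paths and distance levels in distance-hereditary graphs -/

namespace SimpleGraph

variable {V : Type*} {G : SimpleGraph V}

/-- `s` is the vertex set of an induced path of length `n` from `a` to `v`. -/
inductive IsInducedPath (G : SimpleGraph V) (a : V) : Set V → V → ℕ → Prop
  | nil : IsInducedPath G a {a} a 0
  | snoc {s : Set V} {u v : V} {n : ℕ} (h : IsInducedPath G a s u n) (huv : G.Adj u v)
      (hs : ∀ x ∈ s, x ≠ u → ¬ G.Adj x v) (hv : v ∉ s) : IsInducedPath G a (insert v s) v (n + 1)

namespace IsInducedPath

variable {a v : V} {s : Set V} {n : ℕ}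

theorem mem (h : G.IsInducedPath a s v n) : v ∈ s := by
  cases h <;> simp

theorem mem_start (h : G.IsInducedPath a s v n) : a ∈ s := by
  induction h with
  | nil => rfl
  | snoc _ _ _ _ ih => exact Or.inr ih

theorem connected (h : G.IsInducedPath a s v n) : (G.induce s).Connected := by
  induction h with
  | nil =>
    have : Subsingleton ({a} : Set V) := ⟨fun x y => Subtype.ext (x.2.trans y.2.symm)⟩
    exact { preconnected := fun x y => Subsingleton.elim x y ▸ Reachable.refl _, nonempty := ⟨a, rfl⟩ }
  | snoc h huv _ _ ih => exact ih.induce_insert h.mem huv.symm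

/-- `f` is the position along the path. It changes by at most one across an edge, so no walk inside
the path is shorter than the path itself. -/
theorem exists_height (h : G.IsInducedPath a s v n) : ∃ f : V → ℕ, f a = 0 ∧ f v = n ∧
    (∀ x ∈ s, f x ≤ n) ∧ ∀ x ∈ s, ∀ y ∈ s, G.Adj x y → f y ≤ f x + 1 := by
  classical
  induction h with
  | nil => exact ⟨fun _ => 0, rfl, rfl, fun _ _ => le_rfl, fun _ _ _ _ _ => Nat.zero_le _⟩
  | @snoc s u v n h huv hs hv ih =>
    obtain ⟨f, hfa, hfu, hle, hlip⟩ := ih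
    have hne : ∀ x ∈ s, x ≠ v := fun x hx e => hv (e ▸ hx)
    have hf : ∀ x ∈ s, Function.update f v (n + 1) x = f x := fun x hx =>
      Function.update_of_ne (hne x hx) _ _
    have hfv : Function.update f v (n + 1) v = n + 1 := Function.update_self _ _ _
    refine ⟨Function.update f v (n + 1), (hf a h.mem_start).trans hfa, hfv, ?_, ?_⟩
    · rintro x (rfl | hx)
      · exact hfv.le
      · rw [hf x hx]
        exact (hle x hx).trans n.le_succ
    · rintro x (rfl | hx) y (rfl | hy) hxy
      · exact absurd rfl hxy.ne
      · rw [hf y hy, hfv]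
        have := hle y hy
        omega
      · rw [hf x hx, hfv]
        by_cases hxu : x = u
        · rw [hxu, hfu]
        · exact absurd hxy (hs x hx hxu)
      · rw [hf x hx, hf y hy]
        exact hlip x hx y hy hxy

theorem le_dist (h : G.IsInducedPath a s v n) (hG : G.IsDistanceHereditary) :
    n ≤ G.dist a v := by
  obtain ⟨f, hfa, hfv, -, hlip⟩ := h.exists_height
  have hwalk : ∀ (x y : s), ∀ W : (G.induce s).Walk x y, f y ≤ f x + W.length := by
    intro x y W
    induction W with
    | nil => simp
    | @cons x b y hadj W ih =>
      have := hlip x x.2 b b.2 hadj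
      rw [Walk.length_cons]
      omega
  obtain ⟨W, hW⟩ := h.connected.exists_walk_length_eq_dist ⟨a, h.mem_start⟩ ⟨v, h.mem⟩
  have := hwalk _ _ W
  rw [hW, hG s h.connected] at this
  simp only [hfa, hfv] at this
  omega

end IsInducedPath

theorem Adj.dist_le_two {a b e : V} (h1 : G.Adj a e) (h2 : G.Adj e b) : G.dist a b ≤ 2 :=
  dist_le (Walk.cons h1 (Walk.cons h2 Walk.nil))

theorem Adj.dist_le_dist_add_one (hG : G.Connected) (a : V) {x y : V} (h : G.Adj x y) :
    G.dist a y ≤ G.dist a x + 1 := by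
  have := hG.dist_triangle (u := a) (v := x) (w := y)
  rwa [dist_eq_one_iff_adj.2 h] at this

theorem Connected.exists_parent (hG : G.Connected) {a z : V} {j : ℕ} (hz : G.dist a z = j + 1) :
    ∃ u, G.Adj u z ∧ G.dist a u = j := by
  obtain ⟨p, hp⟩ := hG.exists_walk_length_eq_dist a z
  refine ⟨p.getVert j, ?_, hG.dist_getVert p hp (by omega)⟩
  have := p.adj_getVert_succ (i := j) (by omega)
  rwa [← hz, ← hp, Walk.getVert_length] at this

/-- Geodesics are induced. That `z` is the only vertex on the last level lets the path be prolonged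
without chords. -/
theorem Connected.exists_isInducedPath (hG : G.Connected) (a : V) (j : ℕ) :
    ∀ z, G.dist a z = j → ∃ s, G.IsInducedPath a s z j ∧
      ∀ x ∈ s, G.dist a x ≤ j ∧ (G.dist a x = j → x = z) := by
  induction j with
  | zero =>
    intro z hz
    obtain rfl := hG.dist_eq_zero_iff.1 hz
    exact ⟨{a}, .nil, by simp⟩
  | succ j ih =>
    intro z hz
    obtain ⟨u, huz, hu⟩ := hG.exists_parent hz
    obtain ⟨s, hs, hle⟩ := ih u hu
    refine ⟨insert z s, hs.snoc huz (fun x hx hxu hxz => ?_) (fun hzs => ?_), ?_⟩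
    · have h1 := hle x hx
      have h2 := hxz.dist_le_dist_add_one hG a
      have h3 : G.dist a x = j := by omega
      exact hxu (h1.2 h3)
    · have := (hle z hzs).1
      omega
    · rintro x (rfl | hx)
      · exact ⟨hz.le, fun _ => rfl⟩
      · have := (hle x hx).1
        exact ⟨by omega, fun h => by omega⟩

namespace IsDistanceHereditary

variable (hD : G.IsDistanceHereditary)

include hD

/-- Induced paths are geodesics here. The vertices need not be assumed distinct: a coincidence would
contradict one of the non-adjacencies. -/
theorem three_le_dist {a b c d : V} (hab : G.Adj a b) (hbc : G.Adj b c) (hcd : G.Adj c d)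
    (hac : ¬ G.Adj a c) (hbd : ¬ G.Adj b d) (had : ¬ G.Adj a d) : 3 ≤ G.dist a d := by
  have h1 : G.IsInducedPath a {b, a} b 1 :=
    IsInducedPath.nil.snoc hab (fun x hx hxa => absurd hx hxa) (by simpa using hab.ne')
  have h2 : G.IsInducedPath a {c, b, a} c 2 := by
    refine h1.snoc hbc ?_ ?_
    · rintro x (rfl | rfl) hx
      · exact absurd rfl hx
      · exact hac
    · rintro (rfl | rfl)
      · exact hbc.ne rfl
      · exact had hcd
  have h3 : G.IsInducedPath a {d, c, b, a} d 3 := by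
    refine h2.snoc hcd ?_ ?_
    · rintro x (rfl | rfl | rfl) hx
      · exact absurd rfl hx
      · exact hbd
      · exact had
    · rintro (rfl | rfl | rfl)
      · exact hcd.ne rfl
      · exact had hab
      · exact hac hcd.symm
  exact h3.le_dist hD

theorem four_le_dist {a b c d e : V} (hab : G.Adj a b) (hbc : G.Adj b c) (hcd : G.Adj c d)
    (hde : G.Adj d e) (hac : ¬ G.Adj a c) (hbd : ¬ G.Adj b d) (had : ¬ G.Adj a d)
    (hae : ¬ G.Adj a e) (hbe : ¬ G.Adj b e) (hce : ¬ G.Adj c e) : 4 ≤ G.dist a e := by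
  have h1 : G.IsInducedPath a {b, a} b 1 :=
    IsInducedPath.nil.snoc hab (fun x hx hxa => absurd hx hxa) (by simpa using hab.ne')
  have h2 : G.IsInducedPath a {c, b, a} c 2 := by
    refine h1.snoc hbc ?_ ?_
    · rintro x (rfl | rfl) hx
      · exact absurd rfl hx
      · exact hac
    · rintro (rfl | rfl)
      · exact hbc.ne rfl
      · exact had hcd
  have h3 : G.IsInducedPath a {d, c, b, a} d 3 := by
    refine h2.snoc hcd ?_ ?_
    · rintro x (rfl | rfl | rfl) hx
      · exact absurd rfl hx
      · exact hbd
      · exact had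
    · rintro (rfl | rfl | rfl)
      · exact hcd.ne rfl
      · exact had hab
      · exact hac hcd.symm
  have h4 : G.IsInducedPath a {e, d, c, b, a} e 4 := by
    refine h3.snoc hde ?_ ?_
    · rintro x (rfl | rfl | rfl | rfl) hx
      · exact absurd rfl hx
      · exact hce
      · exact hbe
      · exact hae
    · rintro (rfl | rfl | rfl | rfl)
      · exact hde.ne rfl
      · exact hbe hbc
      · exact hae hab
      · exact had hde.symm
  exact h4.le_dist hD

/-- Adjacent vertices at the same distance from `a` have the same neighbours closer to `a`. -/
theorem adj_of_adj_same_level (hG : G.Connected) {a x y z : V} {j : ℕ}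
    (hx : G.dist a x = j + 1) (hy : G.dist a y = j + 1) (hz : G.dist a z = j) (hxy : G.Adj x y)
    (hzx : G.Adj z x) : G.Adj z y := by
  by_contra hzy
  -- Otherwise a geodesic to `z` followed by `x` and `y` is an induced path of length `j + 2` ending
  -- at distance `j + 1`.
  obtain ⟨s, hs, hle⟩ := hG.exists_isInducedPath a j z hz
  have hlow : ∀ t ∈ s, t ≠ z → ∀ y, G.dist a y = j + 1 → ¬ G.Adj t y := by
    intro t ht htz y hy hty
    have h1 := hle t ht
    have h2 := hty.dist_le_dist_add_one hG a
    exact htz (h1.2 (by omega))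
  have hnot : ∀ y, G.dist a y = j + 1 → y ∉ s := by
    intro y hy hys
    have := (hle y hys).1
    omega
  have h1 := hs.snoc hzx (fun t ht htz => hlow t ht htz x hx) (hnot x hx)
  have h2 : G.IsInducedPath a (insert y (insert x s)) y (j + 1 + 1) := by
    refine h1.snoc hxy ?_ ?_
    · rintro t (rfl | ht) htx
      · exact absurd rfl htx
      · by_cases htz : t = z
        · rwa [htz]
        · exact hlow t ht htz y hy
    · rintro (rfl | h)
      · exact hxy.ne rfl
      · exact hnot y hy h
  have := h2.le_dist hD
  omega

/-- Vertices at the same distance from `a` with a common neighbour farther from `a` have the same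
neighbours closer to `a`. -/
theorem adj_of_common_child (hG : G.Connected) {a x y z z' : V} {j : ℕ}
    (hx : G.dist a x = j + 2) (hz : G.dist a z = j + 1) (hz' : G.dist a z' = j + 1)
    (hy : G.dist a y = j) (hyz : G.Adj y z) (hzx : G.Adj z x) (hz'x : G.Adj z' x) :
    G.Adj y z' := by
  by_contra hyz'
  have hne : z ≠ z' := by
    rintro rfl
    exact hyz' hyz
  have hzz' : ¬ G.Adj z z' := fun h => hyz' (hD.adj_of_adj_same_level hG hz hz' hy h hyz)
  -- A geodesic to `y` followed by `z`, `x`, `z'` would be an induced path of length `j + 3` ending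
  -- at distance `j + 1`.
  obtain ⟨s, hs, hle⟩ := hG.exists_isInducedPath a j y hy
  have hlow : ∀ t ∈ s, t ≠ y → ∀ y, j + 1 ≤ G.dist a y → ¬ G.Adj t y := by
    intro t ht htz y hy hty
    have h1 := hle t ht
    have h2 := hty.dist_le_dist_add_one hG a
    exact htz (h1.2 (by omega))
  have hnot : ∀ y, j + 1 ≤ G.dist a y → y ∉ s := by
    intro y hy hys
    have := (hle y hys).1
    omega
  have h1 := hs.snoc hyz (fun t ht hty => hlow t ht hty z hz.ge) (hnot z hz.ge)
  have h2 : G.IsInducedPath a (insert x (insert z s)) x (j + 1 + 1) := by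
    refine h1.snoc hzx ?_ ?_
    · rintro t (rfl | ht) htx
      · exact absurd rfl htx
      · intro htx
        have h3 := htx.dist_le_dist_add_one hG a
        have h4 := (hle t ht).1
        omega
    · rintro (rfl | h)
      · exact hzx.ne rfl
      · exact hnot x (by omega) h
  have h3 : G.IsInducedPath a (insert z' (insert x (insert z s))) z' (j + 1 + 1 + 1) := by
    refine h2.snoc hz'x.symm ?_ ?_
    · rintro t (rfl | rfl | ht) htx
      · exact absurd rfl htx
      · exact hzz'
      · by_cases hty : t = y
        · rwa [hty]
        · exact hlow t ht hty z' hz'.ge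
    · rintro (rfl | rfl | h)
      · exact hz'x.ne rfl
      · exact hne rfl
      · exact hnot z' hz'.ge h
  have := h3.le_dist hD
  omega

end IsDistanceHereditary

/-! ### Twins in sets without induced four-vertex paths -/

/-- `G` has no induced path on four vertices inside `M`. -/
def IsPathFourFreeOn (G : SimpleGraph V) (M : Set V) : Prop :=
  ∀ a ∈ M, ∀ b ∈ M, ∀ c ∈ M, ∀ d ∈ M, G.Adj a b → G.Adj b c → G.Adj c d →
    ¬ G.Adj a c → ¬ G.Adj b d → G.Adj a d

theorem IsPathFourFreeOn.mono {M N : Set V} (h : G.IsPathFourFreeOn N) (hMN : M ⊆ N) :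
    G.IsPathFourFreeOn M := fun a ha b hb c hc d hd =>
  h a (hMN ha) b (hMN hb) c (hMN hc) d (hMN hd)

/-- The four-vertex path is self-complementary: `a b c d` becomes `c a d b`. -/
theorem IsPathFourFreeOn.compl {M : Set V} (h : G.IsPathFourFreeOn M) :
    Gᶜ.IsPathFourFreeOn M := by
  intro a ha b hb c hc d hd hab hbc hcd hac hbd
  by_contra had
  have := h c hc a ha d hd b hb
  simp only [compl_adj] at *
  grind [G.adj_comm]

/-- `M` is split into two nonempty parts with no edges between them. -/
def IsSplit (G : SimpleGraph V) (M A B : Set V) : Prop :=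
  A.Nonempty ∧ B.Nonempty ∧ Disjoint A B ∧ A ∪ B = M ∧ ∀ a ∈ A, ∀ b ∈ B, ¬ G.Adj a b

theorem IsSplit.symm {M A B : Set V} (h : G.IsSplit M A B) : G.IsSplit M B A :=
  ⟨h.2.1, h.1, h.2.2.1.symm, (Set.union_comm B A).trans h.2.2.2.1,
    fun b hb a ha hab => h.2.2.2.2 a ha b hb hab.symm⟩

/-- If `v` sees nothing on one side, it joins the other. If it sees all of `M`, it splits off in the
complement. If it sees some `b` in `B` but misses part of `A`, that missed part splits off: an edge
from it to a neighbour `y` of `v` in `A` would continue `b v y` to an induced path. -/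
theorem IsSplit.exists_insert {M A B : Set V} (h : G.IsSplit M A B) {v : V} (hv : v ∉ M)
    (hP : G.IsPathFourFreeOn (insert v M)) :
    ∃ A' B', G.IsSplit (insert v M) A' B' ∨ Gᶜ.IsSplit (insert v M) A' B' := by
  have hnonbr : ∀ {A B : Set V}, G.IsSplit M A B → (∀ x ∈ A, ¬ G.Adj v x) →
      ∃ A' B', G.IsSplit (insert v M) A' B' ∨ Gᶜ.IsSplit (insert v M) A' B' := by
    intro A B h hA
    refine ⟨A, insert v B, Or.inl ⟨h.1, Set.insert_nonempty _ _, ?_, ?_, ?_⟩⟩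
    · rw [Set.disjoint_insert_right]
      exact ⟨fun hvA => hv (h.2.2.2.1 ▸ Or.inl hvA), h.2.2.1⟩
    · rw [Set.union_insert, h.2.2.2.1]
    · rintro a ha b (rfl | hb) hab
      · exact hA a ha hab.symm
      · exact h.2.2.2.2 a ha b hb hab
  have hmixed : ∀ {A B : Set V}, G.IsSplit M A B → (∃ z ∈ A, ¬ G.Adj v z) →
      (∃ b ∈ B, G.Adj v b) →
      ∃ A' B', G.IsSplit (insert v M) A' B' ∨ Gᶜ.IsSplit (insert v M) A' B' := by
    rintro A B h ⟨z, hz, hvz⟩ ⟨b, hb, hvb⟩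
    have hAM : A ⊆ M := h.2.2.2.1 ▸ Set.subset_union_left
    have hBM : B ⊆ M := h.2.2.2.1 ▸ Set.subset_union_right
    have hdisj := Set.disjoint_left.1 h.2.2.1
    refine ⟨{x ∈ A | ¬ G.Adj v x}, insert v ({x ∈ A | G.Adj v x} ∪ B),
      Or.inl ⟨⟨z, hz, hvz⟩, Set.insert_nonempty _ _, ?_, ?_, ?_⟩⟩
    · rw [Set.disjoint_left]
      rintro x ⟨hx, hvx⟩ (rfl | ⟨-, hx'⟩ | hx')
      · exact hv (hAM hx)
      · exact hvx hx'
      · exact hdisj hx hx'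
    · rw [Set.union_insert, ← h.2.2.2.1, ← Set.union_assoc]
      congr 2
      ext x
      simp only [Set.mem_union, Set.mem_ofPred_eq]
      tauto
    · rintro x ⟨hx, hvx⟩ y (rfl | ⟨hy, hvy⟩ | hy) hxy
      · exact hvx hxy.symm
      · have hby := fun e => h.2.2.2.2 y hy b hb (G.adj_symm e)
        exact h.2.2.2.2 x hx b hb (hP b (Or.inr (hBM hb)) v (Or.inl rfl) y (Or.inr (hAM hy)) x
          (Or.inr (hAM hx)) hvb.symm hvy hxy.symm hby hvx).symm
      · exact h.2.2.2.2 x hx y hy hxy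
  by_cases hA : ∀ x ∈ A, ¬ G.Adj v x
  · exact hnonbr h hA
  by_cases hB : ∀ x ∈ B, ¬ G.Adj v x
  · exact hnonbr h.symm hB
  push Not at hA hB
  by_cases hA' : ∃ z ∈ A, ¬ G.Adj v z
  · exact hmixed h hA' hB
  by_cases hB' : ∃ z ∈ B, ¬ G.Adj v z
  · exact hmixed h.symm hB' hA
  push Not at hA' hB'
  refine ⟨{v}, M, Or.inr ⟨Set.singleton_nonempty v, ?_, ?_, ?_, ?_⟩⟩
  · rw [← h.2.2.2.1]
    exact h.1.inl
  · simpa using hv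
  · exact Set.singleton_union
  · rintro a rfl b hb hab
    rw [compl_adj] at hab
    rw [← h.2.2.2.1] at hb
    exact hab.2 (hb.elim (hA' b) (hB' b))

/-- Seinsche's theorem on cographs, by adding vertices one at a time and passing to the complement
when necessary. -/
theorem IsPathFourFreeOn.exists_isSplit (M : Finset V) (hM : 2 ≤ M.card)
    (hP : G.IsPathFourFreeOn M) : ∃ A B, G.IsSplit M A B ∨ Gᶜ.IsSplit M A B := by
  classical
  induction M using Finset.induction_on with
  | empty => simp at hM
  | insert v M hv ih =>
    rw [Finset.coe_insert] at hP ⊢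
    rw [Finset.card_insert_of_notMem hv] at hM
    have hv' : v ∉ (M : Set V) := by simpa using hv
    by_cases hM' : 2 ≤ M.card
    · obtain ⟨A, B, h | h⟩ := ih hM' (hP.mono (Set.subset_insert _ _))
      · exact h.exists_insert hv' hP
      · obtain ⟨A', B', h'⟩ := h.exists_insert hv' hP.compl
        rw [compl_compl] at h'
        exact ⟨A', B', h'.symm⟩
    · obtain ⟨x, rfl⟩ := Finset.card_eq_one.1 (by omega : M.card = 1)
      have hvx : v ≠ x := by simpa using hv
      refine ⟨{v}, {x}, ?_⟩
      by_cases hadj : G.Adj v x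
      · refine Or.inr ⟨by simp, by simp, by simpa using hvx, by ext; simp [or_comm], ?_⟩
        rintro a rfl b hb hab
        rw [Set.mem_singleton_iff.1 hb, compl_adj] at hab
        exact hab.2 hadj
      · refine Or.inl ⟨by simp, by simp, by simpa using hvx, by ext; simp [or_comm], ?_⟩
        rintro a rfl b hb hab
        rw [Set.mem_singleton_iff.1 hb] at hab
        exact hadj hab

/-- Vertices on the same side of a split of `G` or `Gᶜ` agree on the other side, so twins within a
side are twins in `M`. If both sides are singletons, their two vertices are twins. -/
theorem IsPathFourFreeOn.exists_twins (M : Finset V) (hM : 2 ≤ M.card)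
    (hP : G.IsPathFourFreeOn M) : ∃ x ∈ M, ∃ y ∈ M, x ≠ y ∧
      ∀ z ∈ M, z ≠ x → z ≠ y → (G.Adj x z ↔ G.Adj y z) := by
  classical
  induction M using Finset.strongInduction with
  | H M ih =>
    have hdesc : ∀ A B : Set V, A ∪ B = M → Disjoint A B → B.Nonempty →
        (∀ x ∈ A, ∀ y ∈ A, ∀ z ∈ B, G.Adj x z ↔ G.Adj y z) → A.Nontrivial →
        ∃ x ∈ M, ∃ y ∈ M, x ≠ y ∧ ∀ z ∈ M, z ≠ x → z ≠ y → (G.Adj x z ↔ G.Adj y z) := by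
      intro A B hAB hdisj ⟨b, hb⟩ hunif ⟨c, hc, d, hd, hcd⟩
      have hAM : A ⊆ M := hAB ▸ Set.subset_union_left
      have hcoe : ((M.filter (· ∈ A) : Finset V) : Set V) = A := by
        ext x
        simpa using fun hx => hAM hx
      obtain ⟨x, hx, y, hy, hxy, h⟩ := ih (M.filter (· ∈ A)) (by
        refine Finset.filter_ssubset.2 ⟨b, ?_, fun hbA => Set.disjoint_left.1 hdisj hbA hb⟩
        rw [← Finset.mem_coe, ← hAB]
        exact Or.inr hb) (by
        have : ({c, d} : Finset V) ⊆ M.filter (· ∈ A) := by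
          intro x hx
          rw [Finset.mem_filter]
          rcases Finset.mem_insert.1 hx with rfl | hx
          · exact ⟨hAM hc, hc⟩
          · rw [Finset.mem_singleton.1 hx]
            exact ⟨hAM hd, hd⟩
        rw [← Finset.card_pair hcd]
        exact Finset.card_le_card this) (by rw [hcoe]; exact hP.mono hAM)
      rw [Finset.mem_filter] at hx hy
      refine ⟨x, hx.1, y, hy.1, hxy, fun z hz hzx hzy => ?_⟩
      by_cases hzA : z ∈ A
      · exact h z (Finset.mem_filter.2 ⟨hz, hzA⟩) hzx hzy
      · rw [← Finset.mem_coe, ← hAB] at hz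
        exact hunif x hx.2 y hy.2 z (hz.resolve_left hzA)
    have hunif : ∃ A B : Set V, A ∪ B = M ∧ Disjoint A B ∧ A.Nonempty ∧ B.Nonempty ∧
        (∀ x ∈ A, ∀ y ∈ A, ∀ z ∈ B, G.Adj x z ↔ G.Adj y z) ∧
        (∀ x ∈ B, ∀ y ∈ B, ∀ z ∈ A, G.Adj x z ↔ G.Adj y z) := by
      obtain ⟨A, B, ⟨hA, hB, hd, hu, h⟩ | ⟨hA, hB, hd, hu, h⟩⟩ := hP.exists_isSplit M hM
      · exact ⟨A, B, hu, hd, hA, hB, fun x hx y hy z hz => iff_of_false (h x hx z hz) (h y hy z hz),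
          fun x hx y hy z hz => iff_of_false (fun e => h z hz x hx e.symm)
            (fun e => h z hz y hy e.symm)⟩
      · have h' : ∀ a ∈ A, ∀ b ∈ B, G.Adj a b := fun a ha b hb => by
          by_contra hab
          exact h a ha b hb ⟨fun e => Set.disjoint_left.1 hd ha (e ▸ hb), hab⟩
        exact ⟨A, B, hu, hd, hA, hB, fun x hx y hy z hz => iff_of_true (h' x hx z hz) (h' y hy z hz),
          fun x hx y hy z hz => iff_of_true (h' z hz x hx).symm (h' z hz y hy).symm⟩
    obtain ⟨A, B, hu, hd, hA, hB, h1, h2⟩ := hunif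
    rcases A.subsingleton_or_nontrivial with hAs | hAn
    · rcases B.subsingleton_or_nontrivial with hBs | hBn
      · obtain ⟨x, hx⟩ := hA
        obtain ⟨y, hy⟩ := hB
        have hmem : ∀ z, z ∈ M ↔ z ∈ A ∨ z ∈ B := fun z => by
          rw [← Finset.mem_coe, ← hu]
          rfl
        refine ⟨x, (hmem x).2 (Or.inl hx), y, (hmem y).2 (Or.inr hy), fun e =>
          Set.disjoint_left.1 hd hx (e ▸ hy), fun z hz hzx hzy => ?_⟩
        rcases (hmem z).1 hz with h | h
        · exact absurd (hAs h hx) hzx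
        · exact absurd (hBs h hy) hzy
      · exact hdesc B A ((Set.union_comm B A).trans hu) hd.symm hA h2 hBn
    · exact hdesc A B hu hd hB h1 hAn

/-- A module of `G` that is free of induced paths on four vertices contains twins of `G`. -/
theorem IsPathFourFreeOn.exists_twins_of_module (M : Finset V) (hM : 2 ≤ M.card)
    (hP : G.IsPathFourFreeOn M)
    (hmod : ∀ x ∈ M, ∀ y ∈ M, ∀ z ∉ M, G.Adj z x → G.Adj z y) :
    ∃ x y, x ≠ y ∧ ∀ z, z ≠ x → z ≠ y → (G.Adj x z ↔ G.Adj y z) := by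
  obtain ⟨x, hx, y, hy, hxy, h⟩ := hP.exists_twins M hM
  refine ⟨x, y, hxy, fun z hzx hzy => ?_⟩
  by_cases hz : z ∈ M
  · exact h z hz hzx hzy
  · rw [G.adj_comm x, G.adj_comm y]
    exact ⟨hmod x hx y hy z hz, hmod y hy x hx z hz⟩

end SimpleGraph

/-! ### Pendant vertices and twins in the last distance levels -/

namespace SimpleGraph

/-- A connected distance-hereditary graph with at least two vertices has a pendant vertex or a pair
of twins. -/
theorem IsDistanceHereditary.exists_pendant_or_twins {V : Type*} [Fintype V] [Nontrivial V]
    {G : SimpleGraph V} (hD : G.IsDistanceHereditary) (hG : G.Connected) :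
    (∃ v u, ∀ x, G.Adj v x ↔ x = u) ∨
      ∃ x y, x ≠ y ∧ ∀ z, z ≠ x → z ≠ y → (G.Adj x z ↔ G.Adj y z) := by
  classical
  obtain ⟨a⟩ := hG.nonempty
  obtain ⟨x₀, hx₀⟩ := Finite.exists_max (G.dist a)
  obtain ⟨j, hj⟩ : ∃ j, G.dist a x₀ = j + 1 := by
    obtain ⟨b, hb⟩ := exists_ne a
    have := hG.pos_dist_of_ne hb.symm
    exact ⟨G.dist a x₀ - 1, by have := hx₀ b; omega⟩
  have hmax : ∀ y, G.dist a y ≤ j + 1 := fun y => hj ▸ hx₀ y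
  have hlip : ∀ {x y}, G.Adj x y → G.dist a y ≤ G.dist a x + 1 := fun h =>
    h.dist_le_dist_add_one hG a
  by_cases hedge : ∃ x y, G.dist a x = j + 1 ∧ G.dist a y = j + 1 ∧ G.Adj x y
  · right
    obtain ⟨x, y, hx, hy, hxy⟩ := hedge
    let r : V → V → Prop := fun s t => G.Adj s t ∧ G.dist a s = j + 1 ∧ G.dist a t = j + 1
    have hpar : ∀ t, Relation.ReflTransGen r x t → G.dist a t = j + 1 ∧
        ∀ z, G.dist a z = j → (G.Adj z x ↔ G.Adj z t) := by
      intro t ht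
      induction ht with
      | refl => exact ⟨hx, fun _ _ => Iff.rfl⟩
      | tail _ hst ih =>
        refine ⟨hst.2.2, fun z hz => (ih.2 z hz).trans ⟨fun h => ?_, fun h => ?_⟩⟩
        · exact hD.adj_of_adj_same_level hG hst.2.1 hst.2.2 hz hst.1 h
        · exact hD.adj_of_adj_same_level hG hst.2.2 hst.2.1 hz hst.1.symm h
    -- The component of `x` within the last level. Its vertices have the same neighbours one level
    -- down, so it is a module; a common such neighbour `e` keeps them within distance two, which
    -- excludes induced four-vertex paths.
    let M : Finset V := Finset.univ.filter (Relation.ReflTransGen r x)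
    have hM : ∀ t, t ∈ M ↔ Relation.ReflTransGen r x t := fun t => by simp [M]
    have hxM : x ∈ M := (hM x).2 .refl
    have hyM : y ∈ M := (hM y).2 (.single ⟨hxy, hx, hy⟩)
    obtain ⟨e, hex, he⟩ := hG.exists_parent hx
    refine IsPathFourFreeOn.exists_twins_of_module M ?_ ?_ ?_
    · rw [← Finset.card_pair hxy.ne]
      exact Finset.card_le_card (Finset.insert_subset hxM (Finset.singleton_subset_iff.2 hyM))
    · intro b hb c _ d _ f hf hbc hcd hdf hbd hcf
      by_contra hbf
      have h1 := hD.three_le_dist hbc hcd hdf hbd hcf hbf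
      have h2 := ((hpar b ((hM b).1 hb)).2 e he).1 hex
      have h3 := ((hpar f ((hM f).1 hf)).2 e he).1 hex
      have := h2.symm.dist_le_two h3
      omega
    · intro s hs t ht z hz hzs
      rw [hM] at hs ht hz
      obtain ⟨hs1, hs2⟩ := hpar s hs
      obtain ⟨ht1, ht2⟩ := hpar t ht
      have h1 := hlip hzs
      have h2 := hmax z
      by_cases hzj : G.dist a z = j
      · exact (ht2 z hzj).1 ((hs2 z hzj).2 hzs)
      · exact absurd (hs.tail ⟨hzs.symm, hs1, by omega⟩) hz
  · push Not at hedge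
    -- The last level is now independent. If `x` is not pendant, its neighbourhood is shown to be a
    -- module; minimality of the degree matters only against other vertices of the last level.
    obtain ⟨x, hx, hmin⟩ := Finset.exists_min_image
      (Finset.univ.filter fun x => G.dist a x = j + 1) (fun x => G.degree x) ⟨x₀, by simpa using hj⟩
    simp only [Finset.mem_filter, Finset.mem_univ, true_and] at hx hmin
    have hnbr : ∀ u, G.dist a u = j + 1 → ∀ t, G.Adj u t → G.dist a t = j := by
      intro u hu t hut
      have h1 := hlip hut.symm
      have h2 := hmax t
      have h3 : G.dist a t ≠ j + 1 := fun h => hedge u t hu h hut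
      omega
    by_cases hdeg : G.degree x ≤ 1
    · left
      have hpos := hG.preconnected.degree_pos_of_nontrivial x
      obtain ⟨u, hu, hu'⟩ := degree_eq_one_iff_existsUnique_adj.1 (by omega : G.degree x = 1)
      exact ⟨x, u, fun t => ⟨hu' t, fun e => e ▸ hu⟩⟩
    right
    have hcard : 2 ≤ (G.neighborFinset x).card := by
      rw [card_neighborFinset_eq_degree]
      omega
    obtain ⟨i, rfl⟩ : ∃ i, j = i + 1 := by
      refine Nat.exists_eq_succ_of_ne_zero ?_
      rintro rfl
      obtain ⟨s, hs, t, ht, hst⟩ := Finset.one_lt_card.1 hcard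
      rw [mem_neighborFinset] at hs ht
      exact hst ((hG.dist_eq_zero_iff.1 (hnbr x hx s hs)).symm.trans
        (hG.dist_eq_zero_iff.1 (hnbr x hx t ht)))
    refine IsPathFourFreeOn.exists_twins_of_module (G.neighborFinset x) hcard ?_ ?_
    · intro b hb c _ d _ f hf hbc hcd hdf hbd hcf
      by_contra hbf
      have h1 := hD.three_le_dist hbc hcd hdf hbd hcf hbf
      rw [Finset.mem_coe, mem_neighborFinset] at hb hf
      have := hb.symm.dist_le_two hf
      omega
    · intro z hz z' hz' u hu huz
      rw [mem_neighborFinset] at hz hz' hu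
      have hlz := hnbr x hx z hz
      have hlz' := hnbr x hx z' hz'
      obtain ⟨y, hyz, hy⟩ := hG.exists_parent hlz
      have hyz' := hD.adj_of_common_child hG hx hlz hlz' hy hyz hz.symm hz'.symm
      have hxy : ¬ G.Adj x y := fun h => by
        have := hnbr x hx y h
        omega
      have h1 := hlip huz
      have h2 := hlip huz.symm
      by_cases hui : G.dist a u = i
      · exact hD.adj_of_common_child hG hx hlz hlz' hui huz hz.symm hz'.symm
      by_contra huz'
      by_cases hui' : G.dist a u = i + 1
      -- Here `u y z' x` would be an induced path, although `z` is a common neighbour of `u` and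
      -- `x`.
      · have hyu := hD.adj_of_adj_same_level hG hlz hui' hy huz.symm hyz
        have h3 := hD.three_le_dist hyu.symm hyz' hz'.symm huz' (fun e => hxy e.symm)
          (fun e => hu e.symm)
        have h4 := huz.dist_le_two hz.symm
        omega
      · have hu2 : G.dist a u = i + 1 + 1 := by omega
        -- Since `u` misses `z'` and has degree at least that of `x`, it has a neighbour `t` outside
        -- the neighbourhood of `x`. Then `x z' t u` or `x z' y t u` is induced, although `z` joins
        -- `x` and `u`.
        obtain ⟨t, hut, hxt⟩ : ∃ t, G.Adj u t ∧ ¬ G.Adj x t := by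
          by_contra! hsub
          have h3 : G.neighborFinset u ⊂ G.neighborFinset x := by
            rw [Finset.ssubset_iff_of_subset fun t ht => by
              rw [mem_neighborFinset] at ht ⊢
              exact hsub t ht]
            exact ⟨z', by simpa using hz', by simpa using huz'⟩
          have h4 := Finset.card_lt_card h3
          have h5 := hmin u hu2
          rw [card_neighborFinset_eq_degree, card_neighborFinset_eq_degree] at h4
          omega
        have hlt := hnbr u hu2 t hut
        have hyt := hD.adj_of_common_child hG hu2 hlz hlt hy hyz huz.symm hut.symm
        have hxu : ¬ G.Adj x u := hedge x u hx hu2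
        have hyu : ¬ G.Adj y u := fun h => by
          have := hlip h
          omega
        have h3 := hz.dist_le_two huz.symm
        by_cases hz't : G.Adj z' t
        · have := hD.three_le_dist hz' hz't hut.symm hxt (fun e => huz' e.symm) hxu
          omega
        · have := hD.four_le_dist hz' hyz'.symm hyt hut.symm hxy hz't hxt hxu
            (fun e => huz' e.symm) hyu
          omega

/-! ### Rebuilding unweighted stability -/

variable {V W : Type*} [Fintype V] [Fintype W]

/-- Stability is preserved by adding a pendant vertex. -/
theorem TreeStable.of_pendant {G : SimpleGraph V} (hG : G.Connected) {f : W ↪ V} {v : V}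
    (hf : ∀ x, x ∈ Set.range f ↔ x ≠ v) {u : W} (hu : ∀ x, G.Adj v x ↔ x = f u)
    (h : (G.comap f).TreeStable 1) : G.TreeStable 1 := by
  classical
  rcases subsingleton_or_nontrivial W with hW | hW
  · refine treeStable_of_card_le_two hG (fun _ _ => one_pos) ?_
    have := card_eq_of_range_eq_compl hf
    rw [Nat.card_eq_fintype_card, Nat.card_eq_fintype_card] at this
    have := Fintype.card_le_one_iff_subsingleton.2 hW
    omega
  intro z hz
  -- A pendant vertex has exponent zero in every spanning tree, so its variable may be set to zero.
  have h1 : G.treeSum 1 z = G.treeSum 1 (Function.update z v 0) := by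
    refine Finset.sum_congr rfl fun T hT => ?_
    congr 1
    refine Finset.prod_congr rfl fun x _ => ?_
    by_cases hx : x = v
    · subst hx
      have : T.degree x ≤ 1 := by
        rw [← card_neighborFinset_eq_degree, ← Finset.card_singleton (f u)]
        refine Finset.card_le_card fun y hy => ?_
        rw [Finset.mem_singleton, ← hu]
        exact (mem_spanningTrees.1 hT).1 (by simpa using hy)
      rw [Nat.sub_eq_zero_of_le this, pow_zero, pow_zero]
    · rw [Function.update_of_ne hx]
  rw [h1, treeSum_of_apply_eq_zero hf G 1 _ (Function.update_self _ _ _)]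
  have h2 : Function.update z v 0 ∘ f = z ∘ f :=
    funext fun y => Function.update_of_ne (ne_of_range hf y) _ _
  refine mul_ne_zero ?_ ?_
  · rw [h2]
    exact h _ fun y => hz _
  · have h3 : (Finset.univ.filter fun y => G.Adj v (f y)) = {u} := by
      ext y
      simp [hu, f.injective.eq_iff]
    rw [h3, Finset.sum_singleton, Function.update_of_ne (ne_of_range hf u)]
    simp only [Pi.one_apply, Complex.ofReal_one, one_mul]
    intro e
    have := hz (f u)
    rw [e] at this
    exact lt_irrefl _ this

/-- Stability is preserved by adding a twin. -/
theorem TreeStable.of_twins {G : SimpleGraph V} (hG : G.Connected) {f : W ↪ V} {v : V}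
    (hf : ∀ x, x ∈ Set.range f ↔ x ≠ v) {u : W}
    (hu : ∀ x, x ≠ f u → x ≠ v → (G.Adj (f u) x ↔ G.Adj v x))
    (h : (G.comap f).TreeStable 1) : G.TreeStable 1 := by
  classical
  rcases subsingleton_or_nontrivial W with hW | hW
  · refine treeStable_of_card_le_two hG (fun _ _ => one_pos) ?_
    have := card_eq_of_range_eq_compl hf
    rw [Nat.card_eq_fintype_card, Nat.card_eq_fintype_card] at this
    have := Fintype.card_le_one_iff_subsingleton.2 hW
    omega
  have : Nontrivial V := f.injective.nontrivial
  intro z hz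
  have hne := ne_of_range hf
  rw [treeSum_one_of_twins G (hne u) hu, treeSum_of_apply_eq_zero hf G 1 _
    (Function.update_self _ _ _)]
  set z' := Function.update (Function.update z (f u) (z (f u) + z v)) v 0
  have hz' : ∀ y, 0 < (z' (f y)).im := by
    intro y
    simp only [z']
    rw [Function.update_of_ne (hne y)]
    by_cases hy : f y = f u
    · rw [hy, Function.update_self, Complex.add_im]
      exact add_pos (hz _) (hz _)
    · rw [Function.update_of_ne hy]
      exact hz _
  -- The remaining factor is a nonempty sum of points of the upper half-plane.
  refine mul_ne_zero (h _ hz') fun e => ?_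
  have him := congrArg Complex.im e
  simp only [Pi.one_apply, Complex.ofReal_one, one_mul, Complex.im_sum, Complex.zero_im] at him
  refine (Finset.sum_pos (fun y _ => hz' y) ?_).ne' him
  have hpos := hG.preconnected.degree_pos_of_nontrivial v
  rw [degree_pos_iff_exists_adj] at hpos
  obtain ⟨x, hx⟩ := hpos
  obtain ⟨y, rfl⟩ := (hf x).2 hx.ne'
  exact ⟨y, by simpa using hx⟩

/-- A weighted stable graph is stable. -/
theorem TreeStable.one {V : Type*} [Fintype V] {G : SimpleGraph V} (hG : G.Connected)
    {w : Sym2 V → ℝ} (hw : ∀ e ∈ G.edgeSet, 0 < w e) (h : G.TreeStable w) : G.TreeStable 1 := by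
  classical
  induction hn : Fintype.card V generalizing V with
  | zero => exact treeStable_of_card_le_two hG (fun _ _ => one_pos) (by omega)
  | succ n ih =>
    rcases subsingleton_or_nontrivial V with hV | hV
    · exact treeStable_of_card_le_two hG (fun _ _ => one_pos)
        ((Fintype.card_le_one_iff_subsingleton.2 hV).trans one_le_two)
    have hf : ∀ v x : V, x ∈ Set.range (Function.Embedding.subtype (· ≠ v)) ↔ x ≠ v := by simp
    have hcard : ∀ v : V, Fintype.card {x // x ≠ v} = n := fun v => by
      rw [Fintype.card_subtype_compl, Fintype.card_subtype_eq]
      omega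
    -- Weighted stability is what the induction carries down, supplying a pendant vertex or twins at
    -- each stage; unit-weight stability is carried back up.
    rcases (h.isDistanceHereditary hG hw).exists_pendant_or_twins hG with
      ⟨v, u, hu⟩ | ⟨u, v, huv, hu⟩
    · have huv : u ≠ v := ((hu u).2 rfl).ne'
      have hH := hG.comap_of_dominated (hf v) ⟨u, huv⟩ fun x hx => Or.inl ((hu x).1 hx)
      exact TreeStable.of_pendant hG (hf v) (u := ⟨u, huv⟩) hu
        (ih hH (weight_comap_pos hw _) (h.comap hG hw _ hH) (hcard v))
    · have hH := hG.comap_of_dominated (hf v) ⟨u, huv⟩ fun x hx =>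
        or_iff_not_imp_left.2 fun hxu => (hu x hxu hx.ne').2 hx
      exact TreeStable.of_twins hG (hf v) (u := ⟨u, huv⟩) hu
        (ih hH (weight_comap_pos hw _) (h.comap hG hw _ hH) (hcard v))

end SimpleGraph

theorem mainTheorem4 {V : Type*} [Fintype V] (G : SimpleGraph V) (hG : G.Connected)
    (w : Sym2 V → ℝ) (hw : ∀ e ∈ G.edgeSet, 0 < w e)
    (hstable : (G.weightedVertexSpanningPoly w).IsRealStable) :
    G.IsStable ∧ G.IsDistanceHereditary := by
  rw [SimpleGraph.isRealStable_weightedVertexSpanningPoly_iff] at hstable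
  exact ⟨(SimpleGraph.isStable_iff_treeStable_one G).2 (hstable.one hG hw),
    hstable.isDistanceHereditary hG hw⟩
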